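/- **Setting.** Let $k\ge 2$, $n\ge 0$, and let $f_1,\dots,f_k$ be similitudes of $\mathbb R^d$ with a common contraction ratio $q\in(0,1)$ and attractor $K=\bigcup_i f_i(K)$ (nonempty, compact); put $f_w=f_{w_1}\circ\dots\circ f_{w_m}$ and $K_w=f_w(K)$ for words $w$ of length $|w|=m$. Let $p=(p_1,\dots,p_k)$ be a probability vector with all $p_i>0$, $\mu$ the Bernoulli measure on $\Sigma=\{1,\dots,k\}^{\mathbb N}$ given by $p$, $\pi_K:\Sigma\to K$ the natural projection, and assume that $\mu$-almost every $w$ is the only code of $\pi_K(w)$. Let $\pi_Q:\Sigma\to Q=[0,1]$ be the natural projection of the model system $g_i(x)=(x+i-1)/k$, and $\nu=(\pi_K)_*\mu$, $\lambda=(\pi_Q)_*\mu$ (Lebesgue measure when $p$ is uniform). Let $\Phi^{-1}=\pi_Q\circ\pi_K^{-1}:K\to Q$ (defined up to null sets) and $T^{-1}:L^2(Q,\lambda;\mathbb R^n)\to L^2(K,\nu;\mathbb R^n)$, $T^{-1}g=g\circ\Phi^{-1}$. Let $\mathbf A$ generate a $C_0$-semigroup $(S(t))_{t\ge0}$ on $L^2(Q,\lambda;\mathbb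 R^n)$. Let $X$ be a Banach space embedded continuously and densely in $L^2(Q,\lambda;\mathbb R^n)$, with $X\subset\mathcal D(\mathbf A)$. For $\varepsilon>0$ let $\sigma_\varepsilon\in L^2(Q\times Q)$ be a kernel with values in the $n\times n$ real matrices (with the operator norm; scalar kernels $s$ are included as $s\cdot\mathrm{Id}$) and $\mathbf A_\varepsilon u(x)=\int_Q\sigma_\varepsilon(x,y)u(y)\,d\lambda(y)$. Assume that there are a function $r$ with $r(\varepsilon)\to0$ as $\varepsilon\to0^+$, constants $M\ge1$, $\omega\in\mathbb R$, and a dense subspace $\mathcal D_0$ of $X$ that is a core for $\mathbf A$, such that for all $\varepsilon>0$ the semigroup $S_\varepsilon$ generated by $\mathbf A_\varepsilon$ satisfies $\|S_\varepsilon(t)\|\le Me^{\omega t}$ for all $t\ge0$, and $\|\mathbf A_\varepsilon\varphi-\mathbf A\varphi\|_{L^2}\le r(\varepsilon)\|\varphi\|_X$ for all $\varphi\in\mathcal D_0$. Let $u^0\in X$, $u(t)=S(t)u^0$, $\tilde u(t)=T^{-1}u(t)$, $\tilde u^0=T^{-1}u^0$, and let $T>0$ be such that $u(t)\in X$ for $t\in[0,T]$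 with $\sup_{t\in[0,T]}\|u(t)\|_X<\infty$. Let $\tilde\sigma_\varepsilon(x,y)=\sigma_\varepsilon(\Phi^{-1}(x),\Phi^{-1}(y))$; let $\tilde\sigma^{(\varepsilon)}_{wv}$ be its mean over $K_w\times K_v$ with respect to $\nu\times\nu$, and $\tilde\sigma_{\varepsilon,m}=\sum_{|w|=|v|=m}\tilde\sigma^{(\varepsilon)}_{wv}\mathbf 1_{K_w\times K_v}$. Let $P_m$ be the orthogonal projector of $L^2(K,\nu;\mathbb R^n)$ onto the span $\mathcal H_m$ of the $\mathbb R^n$-valued multiples of $\mathbf 1_{K_w}$, $|w|=m$. For $m\in\mathbb N=\{0,1,2,\dots\}$ let $\tilde u_{\varepsilon,m}(t)=\sum_{|w|=m}u^\varepsilon_w(t)\mathbf 1_{K_w}$ be the Galerkin/particle approximation, where $$\dot u^\varepsilon_w=\sum_{|v|=m}\tilde\sigma^{(\varepsilon)}_{wv}u^\varepsilon_v\,\nu(K_v)\quad(|w|=m),\qquad \tilde u_{\varepsilon,m}(0)=P_m\tilde u^0 .$$ **Assumption.** Let $\alpha,\beta,C>0$ and let $\mathcal P$ be a set of pairs $(\varepsilon,m)$,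 $\varepsilon>0$, $m\in\mathbb N$ (for instance all of them), such that for all $(\varepsilon,m)\in\mathcal P$ $$\|\tilde u^0-P_m\tilde u^0\|_{L^2(K,\nu)}+\|\tilde\sigma_\varepsilon-\tilde\sigma_{\varepsilon,m}\|_{L^2(K\times K,\nu\times\nu)}\le Cq^{\alpha m},\qquad r(\varepsilon)\le C\varepsilon^\beta .$$ Put $N_m=k^m$ and $s=\log k/\log(1/q)$, and write $E_{\varepsilon,m}=\sup_{t\in[0,T]}\|\tilde u_{\varepsilon,m}(t)-\tilde u(t)\|_{L^2(K,\nu)}$. **Conclusion.** There are constants $C_T$, independent of $(\varepsilon,m)\in\mathcal P$, such that: 1. $E_{\varepsilon,m}\le C_T(\varepsilon^\beta+q^{\alpha m})$ for all $(\varepsilon,m)\in\mathcal P$. 2. $E_{\varepsilon,m}\le C_T\,\varepsilon^\beta$ for all $(\varepsilon,m)\in\mathcal P$ with $q^{\alpha m}\le\varepsilon^\beta<q^{\alpha(m-1)}$. 3. $q^m=N_m^{-1/s}$ for all $m$, and $q^{\alpha m}\le\varepsilon^\beta<q^{\alpha(m-1)}$ implies $N_m^{-\alpha/(\beta s)}\le\varepsilon<q^{-\alpha/\beta}N_m^{-\alpha/(\beta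 s)}$. Moreover, for all $c_1,c_2>0$ there is $C_T$ (depending also on $c_1,c_2$) such that $E_{\varepsilon,m}\le C_T N_m^{-\alpha/s}$ for all $(\varepsilon,m)\in\mathcal P$ with $c_1N_m^{-\alpha/(\beta s)}\le\varepsilon\le c_2N_m^{-\alpha/(\beta s)}$. -/

import Mathlib

open MeasureTheory Filter Topology Set
open scoped ENNReal NNReal

noncomputable section

/-! ### Self-similar sets, codings and self-similar measures -/

/-- A finite family of contracting similitudes `f_i` of a metric space together with its
attractor: the (unique) nonempty compact set `carrier` with `carrier = ⋃ i, f_i (carrier)`. -/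
structure SelfSimilarSet (k : ℕ) (V : Type*) [MetricSpace V] where
  map : Fin k → V → V
  ratio : Fin k → ℝ
  ratio_pos : ∀ i, 0 < ratio i
  ratio_lt_one : ∀ i, ratio i < 1
  dist_map : ∀ i x y, dist (map i x) (map i y) = ratio i * dist x y
  carrier : Set V
  isCompact_carrier : IsCompact carrier
  nonempty_carrier : carrier.Nonempty
  carrier_eq : carrier = ⋃ i, map i '' carrier

/-- The Bernoulli measure on the symbolic space `ℕ → Fin k` with probability vector `p`. -/
def symbolicBernoulli {k : ℕ} (p : PMF (Fin k)) : Measure (ℕ → Fin k) :=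
  Measure.infinitePi (fun _ => p.toMeasure)

instance {k : ℕ} (p : PMF (Fin k)) : IsProbabilityMeasure (symbolicBernoulli p) := by
  unfold symbolicBernoulli; infer_instance

namespace SelfSimilarSet

section Coding

variable {k : ℕ} {V : Type*} [MetricSpace V] (F : SelfSimilarSet k V)

/-- `f_w = f_{w_1} ∘ ⋯ ∘ f_{w_m}` for a word `w` of length `m`. -/
def wordMap : (m : ℕ) → (Fin m → Fin k) → V → V
  | 0, _ => id
  | m + 1, w => F.map (w 0) ∘ wordMap m (Fin.tail w)

/-- The cell `K_w = f_w(K)`. -/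
def cell {m : ℕ} (w : Fin m → Fin k) : Set V := F.wordMap m w '' F.carrier

theorem continuous_map (i : Fin k) : Continuous (F.map i) := by
  have : LipschitzWith (F.ratio i).toNNReal (F.map i) :=
    LipschitzWith.of_dist_le_mul fun x y => by
      rw [F.dist_map, Real.coe_toNNReal _ (F.ratio_pos i).le]
  exact this.continuous

theorem continuous_wordMap : ∀ (m : ℕ) (w : Fin m → Fin k), Continuous (F.wordMap m w)
  | 0, _ => continuous_id
  | m + 1, w => (F.continuous_map _).comp (continuous_wordMap m (Fin.tail w))

theorem map_carrier_subset (i : Fin k) : F.map i '' F.carrier ⊆ F.carrier := by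
  conv_rhs => rw [F.carrier_eq]
  exact subset_iUnion (fun i => F.map i '' F.carrier) i

theorem isCompact_cell {m : ℕ} (w : Fin m → Fin k) : IsCompact (F.cell w) :=
  F.isCompact_carrier.image (F.continuous_wordMap m w)

theorem cell_succ_subset : ∀ (m : ℕ) (w : ℕ → Fin k),
    F.cell (fun i : Fin (m + 1) => w i) ⊆ F.cell (fun i : Fin m => w i)
  | 0, w => by
      rintro _ ⟨x, hx, rfl⟩
      exact ⟨F.map (w 0) x, F.map_carrier_subset _ ⟨x, hx, rfl⟩, rfl⟩
  | m + 1, w => by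
      rintro _ ⟨x, hx, rfl⟩
      obtain ⟨y, hy, hyx⟩ := cell_succ_subset m (fun i => w (i + 1)) ⟨x, hx, rfl⟩
      refine ⟨y, hy, ?_⟩
      change F.map (w 0) (F.wordMap m (fun i => w (i + 1)) y) =
        F.map (w 0) (F.wordMap (m + 1) (fun i => w (i + 1)) x)
      rw [hyx]

theorem iInter_cell_nonempty (w : ℕ → Fin k) :
    (⋂ m, F.cell (fun i : Fin m => w i)).Nonempty :=
  IsCompact.nonempty_iInter_of_sequence_nonempty_isCompact_isClosed _
    (fun m => F.cell_succ_subset m w) (fun _ => F.nonempty_carrier.image _)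
    (F.isCompact_cell _) (fun _ => (F.isCompact_cell _).isClosed)

/-- The natural projection `π : Σ → K`, sending `w` to the point of `⋂ m, K_{w_1 … w_m}`. -/
def coding (w : ℕ → Fin k) : V := (F.iInter_cell_nonempty w).some

theorem coding_mem (w : ℕ → Fin k) (m : ℕ) : F.coding w ∈ F.cell (fun i : Fin m => w i) :=
  mem_iInter.1 (F.iInter_cell_nonempty w).some_mem m

theorem exists_ratio_bound : ∃ ρ : ℝ, 0 < ρ ∧ ρ < 1 ∧ ∀ i, F.ratio i ≤ ρ := by
  rcases isEmpty_or_nonempty (Fin k) with h | h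
  · exact ⟨1 / 2, by norm_num, by norm_num, fun i => (h.false i).elim⟩
  · obtain ⟨j, hj⟩ := Finite.exists_max F.ratio
    exact ⟨F.ratio j, F.ratio_pos j, F.ratio_lt_one j, hj⟩

theorem dist_wordMap_le {ρ : ℝ} (h0 : 0 < ρ) (h : ∀ i, F.ratio i ≤ ρ) :
    ∀ (m : ℕ) (w : Fin m → Fin k) (x y : V),
      dist (F.wordMap m w x) (F.wordMap m w y) ≤ ρ ^ m * dist x y
  | 0, _, x, y => by simp [wordMap]
  | m + 1, w, x, y => by
      change dist (F.map (w 0) _) (F.map (w 0) _) ≤ _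
      rw [F.dist_map, pow_succ', mul_assoc]
      exact mul_le_mul (h _) (dist_wordMap_le h0 h m _ x y) dist_nonneg h0.le

theorem continuous_coding : Continuous F.coding := by
  obtain ⟨ρ, h0, h1, hρ⟩ := F.exists_ratio_bound
  rw [continuous_iff_continuousAt]
  intro w
  rw [ContinuousAt, Metric.tendsto_nhds]
  intro δ hδ
  have hlim : Tendsto (fun m : ℕ => ρ ^ m * Metric.diam F.carrier) atTop (𝓝 0) := by
    simpa using (tendsto_pow_atTop_nhds_zero_of_lt_one h0.le h1).mul_const
      (Metric.diam F.carrier)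
  obtain ⟨m, hm⟩ := ((tendsto_order.1 hlim).2 δ hδ).exists
  have hev : ∀ᶠ v in 𝓝 w, ∀ i : Fin m, v i = w i := by
    rw [eventually_all]
    intro i
    exact (continuous_apply (i : ℕ)).continuousAt.eventually_mem
      (show {w (i : ℕ)} ∈ 𝓝 (w (i : ℕ)) from mem_nhds_discrete.2 rfl)
  filter_upwards [hev] with v hv
  obtain ⟨x, hx, hxv⟩ := F.coding_mem v m
  obtain ⟨y, hy, hyw⟩ := F.coding_mem w m
  rw [← hxv, ← hyw, show (fun i : Fin m => v i) = fun i : Fin m => w i from funext hv]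
  refine (F.dist_wordMap_le h0 hρ m _ x y).trans_lt (lt_of_le_of_lt ?_ hm)
  exact mul_le_mul_of_nonneg_left
    (Metric.dist_le_diam_of_mem F.isCompact_carrier.isBounded hx hy) (pow_nonneg h0.le m)

/-- The set of sequences `w` whose point `π(w)` has more than one code. -/
def multiCoded : Set (ℕ → Fin k) := {w | ∃ v, v ≠ w ∧ F.coding v = F.coding w}

end Coding

section Measure

variable {k : ℕ} {V : Type*} [MetricSpace V] [MeasurableSpace V] [BorelSpace V]
  (F : SelfSimilarSet k V) (p : PMF (Fin k))

theorem measurableSet_cell {m : ℕ} (w : Fin m → Fin k) : MeasurableSet (F.cell w) :=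
  (F.isCompact_cell w).isClosed.measurableSet

theorem measurable_coding : Measurable F.coding := F.continuous_coding.measurable

/-- The self-similar measure: the image of the Bernoulli measure under the natural projection. It
is a measure on the ambient space which is carried by the self-similar set. -/
def measure : Measure V := (symbolicBernoulli p).map F.coding

instance : IsProbabilityMeasure (F.measure p) :=
  Measure.isProbabilityMeasure_map F.measurable_coding.aemeasurable

theorem measurePreserving_coding :
    MeasurePreserving F.coding (symbolicBernoulli p) (F.measure p) :=
  ⟨F.measurable_coding, rfl⟩

variable [SecondCountableTopology V]

theorem exists_decode (hN : symbolicBernoulli p F.multiCoded = 0) :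
    ∃ s : V → ℕ → Fin k, Measurable s ∧ ∀ᵐ w ∂(symbolicBernoulli p), s (F.coding w) = w := by
  classical
  set B : Set (ℕ → Fin k) := (toMeasurable (symbolicBernoulli p) F.multiCoded)ᶜ with hB
  have hBm : MeasurableSet B := (measurableSet_toMeasurable _ _).compl
  have hae : ∀ᵐ w ∂(symbolicBernoulli p), w ∈ B := by
    rw [ae_iff]
    simpa [hB] using hN
  have hinj : InjOn F.coding B := by
    intro v _ w hw hvw
    by_contra hne
    exact hw (subset_toMeasurable _ _ ⟨v, hne, hvw⟩)
  have : StandardBorelSpace B := hBm.standardBorel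
  have hemb : MeasurableEmbedding (fun w : B => F.coding w) :=
    Measurable.measurableEmbedding (F.measurable_coding.comp measurable_subtype_coe)
      (fun v w h => Subtype.ext (hinj v.2 w.2 h))
  obtain ⟨w₀, -⟩ := hae.exists
  obtain ⟨s, hs, hs'⟩ := hemb.exists_measurable_extend
    (g := (Subtype.val : B → ℕ → Fin k)) measurable_subtype_coe (fun _ => ⟨w₀⟩)
  exact ⟨s, hs, hae.mono fun w hw => congrFun hs' ⟨w, hw⟩⟩

/-- A measurable inverse of the natural projection (determined up to null sets), when almost every
point has a single code. -/
def decode (hN : symbolicBernoulli p F.multiCoded = 0) : V → ℕ → Fin k := (F.exists_decode p hN).choose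

theorem measurable_decode (hN : symbolicBernoulli p F.multiCoded = 0) : Measurable (F.decode p hN) :=
  (F.exists_decode p hN).choose_spec.1

theorem decode_coding (hN : symbolicBernoulli p F.multiCoded = 0) :
    ∀ᵐ w ∂(symbolicBernoulli p), F.decode p hN (F.coding w) = w :=
  (F.exists_decode p hN).choose_spec.2

theorem measurePreserving_decode (hN : symbolicBernoulli p F.multiCoded = 0) :
    MeasurePreserving (F.decode p hN) (F.measure p) (symbolicBernoulli p) := by
  refine ⟨F.measurable_decode p hN, ?_⟩
  have h : F.decode p hN ∘ F.coding =ᵐ[symbolicBernoulli p] id := F.decode_coding p hN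
  rw [measure, Measure.map_map (F.measurable_decode p hN) F.measurable_coding,
    Measure.map_congr h, Measure.map_id]

end Measure

end SelfSimilarSet

/-- The model IFS `x ↦ (x + i) / k`, `i = 0, …, k - 1`, with attractor `Q = [0,1]`. -/
def unitIntervalIFS (k : ℕ) (hk : 2 ≤ k) : SelfSimilarSet k ℝ where
  map i x := (x + i) / k
  ratio _ := 1 / k
  ratio_pos _ := by positivity
  ratio_lt_one _ := by
    have : (2 : ℝ) ≤ k := by exact_mod_cast hk
    rw [div_lt_one (by positivity)]
    linarith
  dist_map i x y := by
    rw [Real.dist_eq, Real.dist_eq, ← sub_div, abs_div, Nat.abs_cast]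
    ring_nf
  carrier := Icc 0 1
  isCompact_carrier := isCompact_Icc
  nonempty_carrier := ⟨0, by simp⟩
  carrier_eq := by
    have hk0 : (0 : ℝ) < k := by positivity
    ext x
    simp only [mem_iUnion, mem_image, mem_Icc]
    constructor
    · rintro ⟨h0, h1⟩
      rcases h1.eq_or_lt with rfl | h1
      · refine ⟨⟨k - 1, by omega⟩, 1, by simp, ?_⟩
        have : ((k - 1 : ℕ) : ℝ) = k - 1 := by
          rw [Nat.cast_sub (by omega)]; simp
        simp only [this]
        field_simp
        ring
      · have hx : 0 ≤ (k : ℝ) * x := by positivity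
        have hlt : ⌊(k : ℝ) * x⌋₊ < k := by
          rw [Nat.floor_lt hx]
          nlinarith
        refine ⟨⟨_, hlt⟩, (k : ℝ) * x - ⌊(k : ℝ) * x⌋₊, ⟨?_, ?_⟩, ?_⟩
        · linarith [Nat.floor_le hx]
        · linarith [Nat.lt_floor_add_one ((k : ℝ) * x)]
        · field_simp
          ring
    · rintro ⟨i, y, ⟨h0, h1⟩, rfl⟩
      have hi : ((i : ℕ) : ℝ) + 1 ≤ k := by exact_mod_cast i.2
      refine ⟨by positivity, ?_⟩
      rw [div_le_one hk0]
      linarith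

/-- The measure `λ_p` on `Q = [0,1]`: the self-similar measure of the model IFS. For the uniform
probability vector it is Lebesgue measure on `[0,1]`. -/
abbrev unitMeasure {k : ℕ} (hk : 2 ≤ k) (p : PMF (Fin k)) : Measure ℝ :=
  (unitIntervalIFS k hk).measure p

/-! ### Function spaces and integral operators -/

/-- `L²(μ; ℝⁿ)`. -/
abbrev L2 {V : Type*} [MeasurableSpace V] (n : ℕ) (μ : Measure V) : Type _ :=
  Lp (EuclideanSpace ℝ (Fin n)) 2 μ

/-- Square-integrable matrix-valued kernels, i.e. kernels with values in the linear maps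
`ℝⁿ → ℝⁿ`, normed by the operator norm. A scalar kernel `s` is the kernel `s • id`. -/
abbrev L2Kernel {V : Type*} [MeasurableSpace V] (n : ℕ) (μ : Measure V) : Type _ :=
  Lp (EuclideanSpace ℝ (Fin n) →L[ℝ] EuclideanSpace ℝ (Fin n)) 2 (μ.prod μ)

section KernelOperator

variable {V : Type*} [MeasurableSpace V] {μ : Measure V} [IsProbabilityMeasure μ] {n : ℕ}

/-- The function `x ↦ ∫ κ(x,y) u(y) dμ(y)`. -/
def kernelFun (κ : L2Kernel n μ) (u : L2 n μ) (x : V) : EuclideanSpace ℝ (Fin n) :=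
  ∫ y, κ (x, y) (u y) ∂μ

theorem lintegral_sq_eq {W E : Type*} [MeasurableSpace W] [NormedAddCommGroup E] {ρ : Measure W}
    (f : W → E) : (∫⁻ x, ‖f x‖ₑ ^ (2 : ℝ) ∂ρ) = eLpNorm f 2 ρ ^ (2 : ℝ) := by
  rw [eLpNorm_eq_lintegral_rpow_enorm_toReal (by norm_num) (by norm_num), ← ENNReal.rpow_mul,
    ENNReal.toReal_ofNat]
  norm_num

theorem lintegral_kernel_le (κ : L2Kernel n μ) (u : L2 n μ) :
    (∫⁻ x, (∫⁻ y, ‖κ (x, y)‖ₑ * ‖u y‖ₑ ∂μ) ^ (2 : ℝ) ∂μ) ≤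
      (eLpNorm κ 2 (μ.prod μ) * eLpNorm u 2 μ) ^ (2 : ℝ) := by
  have hκ : Measurable fun z => ‖κ z‖ₑ := (Lp.stronglyMeasurable κ).enorm
  have hu : Measurable fun y => ‖u y‖ₑ := (Lp.stronglyMeasurable u).enorm
  have key : ∀ x, (∫⁻ y, ‖κ (x, y)‖ₑ * ‖u y‖ₑ ∂μ) ^ (2 : ℝ) ≤
      (∫⁻ y, ‖κ (x, y)‖ₑ ^ (2 : ℝ) ∂μ) * eLpNorm u 2 μ ^ (2 : ℝ) := by
    intro x
    have h := ENNReal.lintegral_mul_le_Lp_mul_Lq μ Real.HolderConjugate.two_two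
      (hκ.comp measurable_prodMk_left : Measurable fun y => ‖κ (x, y)‖ₑ).aemeasurable
      hu.aemeasurable
    refine (ENNReal.rpow_le_rpow h (by norm_num)).trans (le_of_eq ?_)
    rw [ENNReal.mul_rpow_of_nonneg _ _ (by norm_num), ← ENNReal.rpow_mul, ← ENNReal.rpow_mul,
      ← lintegral_sq_eq]
    norm_num
  refine (lintegral_mono key).trans (le_of_eq ?_)
  rw [lintegral_mul_const _ (by fun_prop), ENNReal.mul_rpow_of_nonneg _ _ (by norm_num),
    ← lintegral_sq_eq (ρ := μ.prod μ), lintegral_prod _ (by fun_prop)]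

theorem enorm_kernelFun_le (κ : L2Kernel n μ) (u : L2 n μ) (x : V) :
    ‖kernelFun κ u x‖ₑ ≤ ∫⁻ y, ‖κ (x, y)‖ₑ * ‖u y‖ₑ ∂μ :=
  (enorm_integral_le_lintegral_enorm _).trans
    (lintegral_mono fun _ => ContinuousLinearMap.le_opENorm _ _)

theorem stronglyMeasurable_kernelFun (κ : L2Kernel n μ) (u : L2 n μ) :
    StronglyMeasurable (kernelFun κ u) := by
  have h : StronglyMeasurable fun z : V × V => κ z (u z.2) :=
    isBoundedBilinearMap_apply.continuous.comp_stronglyMeasurable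
      ((Lp.stronglyMeasurable κ).prodMk
        ((Lp.stronglyMeasurable u).comp_measurable measurable_snd))
  exact h.integral_prod_right'

theorem eLpNorm_kernelFun_le (κ : L2Kernel n μ) (u : L2 n μ) :
    eLpNorm (kernelFun κ u) 2 μ ≤ eLpNorm κ 2 (μ.prod μ) * eLpNorm u 2 μ := by
  rw [← ENNReal.rpow_le_rpow_iff (show (0 : ℝ) < 2 by norm_num), ← lintegral_sq_eq]
  exact (lintegral_mono fun x => ENNReal.rpow_le_rpow (enorm_kernelFun_le κ u x)
    (by norm_num)).trans (lintegral_kernel_le κ u)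

theorem memLp_kernelFun (κ : L2Kernel n μ) (u : L2 n μ) : MemLp (kernelFun κ u) 2 μ :=
  ⟨(stronglyMeasurable_kernelFun κ u).aestronglyMeasurable,
    (eLpNorm_kernelFun_le κ u).trans_lt
      (ENNReal.mul_lt_top (Lp.eLpNorm_lt_top κ) (Lp.eLpNorm_lt_top u))⟩

theorem integrable_kernel (κ : L2Kernel n μ) (u : L2 n μ) :
    ∀ᵐ x ∂μ, Integrable (fun y => κ (x, y) (u y)) μ := by
  have hκ : Measurable fun z => ‖κ z‖ₑ := (Lp.stronglyMeasurable κ).enorm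
  have hu : Measurable fun y => ‖u y‖ₑ := (Lp.stronglyMeasurable u).enorm
  have hfin : (∫⁻ x, (∫⁻ y, ‖κ (x, y)‖ₑ * ‖u y‖ₑ ∂μ) ^ (2 : ℝ) ∂μ) ≠ ∞ := by
    refine ne_top_of_le_ne_top ?_ (lintegral_kernel_le κ u)
    exact ENNReal.rpow_ne_top_of_nonneg (by norm_num)
      (ENNReal.mul_lt_top (Lp.eLpNorm_lt_top κ) (Lp.eLpNorm_lt_top u)).ne
  filter_upwards [ae_lt_top (by fun_prop) hfin] with x hx
  have hm : StronglyMeasurable fun y => κ (x, y) (u y) :=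
    isBoundedBilinearMap_apply.continuous.comp_stronglyMeasurable
      (((Lp.stronglyMeasurable κ).comp_measurable measurable_prodMk_left).prodMk
        (Lp.stronglyMeasurable u))
  refine ⟨hm.aestronglyMeasurable, ?_⟩
  refine lt_of_le_of_lt (lintegral_mono fun _ => ContinuousLinearMap.le_opENorm _ _) ?_
  by_contra htop
  rw [not_lt, top_le_iff] at htop
  rw [htop] at hx
  simp at hx

/-- The integral operator `(A u)(x) = ∫ κ(x,y) u(y) dμ(y)` on `L²(μ; ℝⁿ)`. -/
def kernelOp (κ : L2Kernel n μ) : L2 n μ →L[ℝ] L2 n μ :=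
  LinearMap.mkContinuous
    { toFun := fun u => (memLp_kernelFun κ u).toLp
      map_add' := fun u v => by
        rw [← MemLp.toLp_add]
        refine MemLp.toLp_congr _ _ ?_
        filter_upwards [integrable_kernel κ u, integrable_kernel κ v] with x hu hv
        rw [Pi.add_apply, kernelFun, kernelFun, kernelFun, ← integral_add hu hv]
        refine integral_congr_ae ?_
        filter_upwards [Lp.coeFn_add u v] with y hy
        rw [hy, Pi.add_apply, map_add]
      map_smul' := fun c u => by
        rw [RingHom.id_apply, ← MemLp.toLp_const_smul]
        refine MemLp.toLp_congr _ _ (Eventually.of_forall fun x => ?_)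
        rw [Pi.smul_apply, kernelFun, kernelFun, ← integral_smul]
        refine integral_congr_ae ?_
        filter_upwards [Lp.coeFn_smul c u] with y hy
        rw [hy, Pi.smul_apply, map_smul] }
    ‖κ‖ (fun u => by
      rw [LinearMap.coe_mk, AddHom.coe_mk, Lp.norm_toLp, Lp.norm_def, Lp.norm_def,
        ← ENNReal.toReal_mul]
      exact ENNReal.toReal_mono
        (ENNReal.mul_lt_top (Lp.eLpNorm_lt_top κ) (Lp.eLpNorm_lt_top u)).ne
        (eLpNorm_kernelFun_le κ u))

theorem kernelOp_coeFn (κ : L2Kernel n μ) (u : L2 n μ) :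
    kernelOp κ u =ᵐ[μ] fun x => ∫ y, κ (x, y) (u y) ∂μ :=
  (memLp_kernelFun κ u).coeFn_toLp

end KernelOperator

/-! ### Transport from `Q` to `K`, Galerkin spaces and the particle system -/

namespace SelfSimilarSet

variable {k : ℕ} {V : Type*} [MetricSpace V] [MeasurableSpace V] [BorelSpace V]
  (F : SelfSimilarSet k V) (p : PMF (Fin k))

section Transport

variable [SecondCountableTopology V]

/-- The map `Φ⁻¹ = π_Q ∘ π_K⁻¹ : K → Q`, defined up to null sets. -/
def toInterval (hk : 2 ≤ k) (hN : symbolicBernoulli p F.multiCoded = 0) (x : V) : ℝ :=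
  (unitIntervalIFS k hk).coding (F.decode p hN x)

theorem measurePreserving_toInterval (hk : 2 ≤ k) (hN : symbolicBernoulli p F.multiCoded = 0) :
    MeasurePreserving (F.toInterval p hk hN) (F.measure p) (unitMeasure hk p) :=
  ((unitIntervalIFS k hk).measurePreserving_coding p).comp (F.measurePreserving_decode p hN)

/-- The transport `T⁻¹ : L²(Q, λ; ℝⁿ) → L²(K, ν; ℝⁿ)`, `T⁻¹ g = g ∘ Φ⁻¹`. -/
def transport (n : ℕ) (hk : 2 ≤ k) (hN : symbolicBernoulli p F.multiCoded = 0) :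
    L2 n (unitMeasure hk p) →ₗᵢ[ℝ] L2 n (F.measure p) :=
  Lp.compMeasurePreservingₗᵢ ℝ (F.toInterval p hk hN) (F.measurePreserving_toInterval p hk hN)

/-- `f = T⁻¹ g` is characterised by `f ∘ π_K = g ∘ π_Q` almost everywhere. -/
theorem transport_comp_coding (n : ℕ) (hk : 2 ≤ k) (hN : symbolicBernoulli p F.multiCoded = 0)
    (g : L2 n (unitMeasure hk p)) :
    (fun w => F.transport p n hk hN g (F.coding w)) =ᵐ[symbolicBernoulli p]
      fun w => g ((unitIntervalIFS k hk).coding w) := by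
  have h := (F.measurePreserving_coding p).quasiMeasurePreserving.ae
    (Lp.coeFn_compMeasurePreserving g (F.measurePreserving_toInterval p hk hN))
  filter_upwards [h, F.decode_coding p hN] with w hw hd
  refine hw.trans ?_
  rw [Function.comp_apply, toInterval, hd]

/-- The lifted kernel `(x, y) ↦ σ(Φ⁻¹ x, Φ⁻¹ y)`. -/
def liftKernel (n : ℕ) (hk : 2 ≤ k) (hN : symbolicBernoulli p F.multiCoded = 0)
    (σ : L2Kernel n (unitMeasure hk p)) : L2Kernel n (F.measure p) :=
  Lp.compMeasurePreserving _ ((F.measurePreserving_toInterval p hk hN).prod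
    (F.measurePreserving_toInterval p hk hN)) σ

end Transport

section Galerkin

variable {n : ℕ}

/-- The step function `∑_{|w| = m} c_w 1_{K_w}`. -/
def stepFun (m : ℕ) :
    ((Fin m → Fin k) → EuclideanSpace ℝ (Fin n)) →ₗ[ℝ] L2 n (F.measure p) where
  toFun c := ∑ w, indicatorConstLp 2 (F.measurableSet_cell w) (measure_ne_top _ _) (c w)
  map_add' c d := by
    rw [← Finset.sum_add_distrib]
    exact Finset.sum_congr rfl fun w _ => indicatorConstLp_add.symm
  map_smul' a c := by
    rw [RingHom.id_apply, Finset.smul_sum]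
    exact Finset.sum_congr rfl fun w _ => by
      refine Eq.trans ?_ (MemLp.toLp_const_smul a _)
      refine MemLp.toLp_congr _ _ (Eventually.of_forall fun x => ?_)
      exact congrFun (indicator_const_smul (F.cell w) a fun _ => c w) x

/-- The space `H_m` of (`ℝⁿ`-valued) functions spanned by the indicators of the level-`m` cells. -/
def galerkinSpace (n m : ℕ) : Submodule ℝ (L2 n (F.measure p)) :=
  LinearMap.range (F.stepFun p (n := n) m)

instance (n m : ℕ) : FiniteDimensional ℝ (F.galerkinSpace p n m) :=
  inferInstanceAs (FiniteDimensional ℝ (LinearMap.range (F.stepFun p (n := n) m)))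

/-- The orthogonal projector `P_m` of `L²(K, ν; ℝⁿ)` onto `H_m`. -/
def galerkinProj (n m : ℕ) : L2 n (F.measure p) →L[ℝ] L2 n (F.measure p) :=
  (F.galerkinSpace p n m).starProjection

/-- The mean `κ_{wv}` of the kernel `κ` over `K_w × K_v`. -/
def kernelMean (κ : L2Kernel n (F.measure p)) {m : ℕ} (w v : Fin m → Fin k) :
    EuclideanSpace ℝ (Fin n) →L[ℝ] EuclideanSpace ℝ (Fin n) :=
  ⨍ z in F.cell w ×ˢ F.cell v, κ z ∂((F.measure p).prod (F.measure p))

/-- The step kernel `∑_{|w| = |v| = m} κ_{wv} 1_{K_w × K_v}`. -/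
def stepKernel (m : ℕ) (κ : L2Kernel n (F.measure p)) : L2Kernel n (F.measure p) :=
  ∑ w : Fin m → Fin k, ∑ v : Fin m → Fin k,
    indicatorConstLp 2 ((F.measurableSet_cell w).prod (F.measurableSet_cell v))
      (measure_ne_top _ _) (F.kernelMean p κ w v)

/-- `c` solves on `[0, ∞)` the level-`m` interacting particle system
`c_w' = ∑_{|v| = m} κ_{wv} c_v ν(K_v)`, with initial state the Galerkin projection of `f₀`.
The Galerkin approximation itself is `t ↦ ∑_{|w| = m} c_w(t) 1_{K_w}`. -/
structure IsIPSSolution (m : ℕ) (κ : L2Kernel n (F.measure p)) (f₀ : L2 n (F.measure p))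
    (c : ℝ → (Fin m → Fin k) → EuclideanSpace ℝ (Fin n)) : Prop where
  initial : F.stepFun p m (c 0) = F.galerkinProj p n m f₀
  hasDerivWithinAt : ∀ t, 0 ≤ t → ∀ w, HasDerivWithinAt (fun s => c s w)
    (∑ v, (F.measure p).real (F.cell v) • F.kernelMean p κ w v (c t v)) (Ici 0) t

end Galerkin

end SelfSimilarSet

/-! ### Semigroups and the stability and consistency requirements -/

/-- A `C₀`-semigroup of bounded operators on a real normed space. -/
structure C0Semigroup (H : Type*) [NormedAddCommGroup H] [NormedSpace ℝ H] where
  op : ℝ≥0 → H →L[ℝ] H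
  op_zero : op 0 = ContinuousLinearMap.id ℝ H
  op_add : ∀ s t, op (s + t) = (op s).comp (op t)
  tendsto_zero : ∀ x, Tendsto (fun t => op t x) (𝓝 0) (𝓝 x)

/-- `A` is the infinitesimal generator of `S`: its graph consists of the pairs `(x, y)` with
`y = lim_{t → 0+} (S(t) x - x) / t`. -/
def C0Semigroup.IsGenerator {H : Type*} [NormedAddCommGroup H] [NormedSpace ℝ H]
    (S : C0Semigroup H) (A : H →ₗ.[ℝ] H) : Prop :=
  ∀ x y, (x, y) ∈ A.graph ↔
    Tendsto (fun t : ℝ≥0 => (t : ℝ)⁻¹ • (S.op t x - x)) (𝓝[>] 0) (𝓝 y)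

/-- Uniform semigroup stability of the bounded operators `Aε ε` (`ε > 0`), and their consistency
with `A`, with error function `r`, on a subspace which is dense in `X` and a core for `A`.
Here `ι : X → H` is the embedding of the regularity space. -/
structure StableConsistent {H X : Type*} [NormedAddCommGroup H] [NormedSpace ℝ H]
    [NormedAddCommGroup X] [NormedSpace ℝ X] (ι : X →L[ℝ] H) (A : H →ₗ.[ℝ] H)
    (Aε : ℝ → H →L[ℝ] H) (r : ℝ → ℝ) : Prop where
  tendsto_r : Tendsto r (𝓝[>] 0) (𝓝 0)
  stable : ∃ M ω : ℝ, 1 ≤ M ∧ ∀ ε, 0 < ε → ∃ S : C0Semigroup H,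
    S.IsGenerator ((Aε ε : H →ₗ[ℝ] H).toPMap ⊤) ∧
      ∀ t : ℝ≥0, ‖S.op t‖ ≤ M * Real.exp (ω * t)
  consistent : ∃ D₀ : Submodule ℝ X, Dense (D₀ : Set X) ∧
    A.HasCore (D₀.map (ι : X →ₗ[ℝ] H)) ∧
    ∀ ε, 0 < ε → ∀ φ ∈ D₀, ∀ h : ι φ ∈ A.domain,
      ‖Aε ε (ι φ) - A ⟨ι φ, h⟩‖ ≤ r ε * ‖φ‖

end

/-! ### Linear evolution equations with a bounded operator -/

section BoundedEvolution

variable {H : Type*} [NormedAddCommGroup H] [NormedSpace ℝ H] [CompleteSpace H]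

/-! The error is split at the nonlocal solution `e^{tA_ε} u⁰`, transported to `K`. Nothing bounds
`‖A_ε‖` uniformly in `ε`, so all final estimates go through the stable exponentials: by Duhamel,
`d/ds e^{(t-s)A} v(s) = e^{(t-s)A} (v' - A v)`, and only the residual of `v` matters.

On `Q`, the orbit `u(t)` solves `v' = A_ε v` with residual `(A - A_ε) u(t)`, of size `r(ε)
‖u(t)‖_X`. Consistency is assumed only on a dense subspace of `X`; it extends to all of `X` because
generators are closed (`StableConsistent.norm_sub_le`). This gives the term `ε^β`
(`norm_exp_sub_orbit_le`).

On `K`, the particle system is the evolution equation of the step kernel, restricted to step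
functions (`kernelOp_stepKernel_stepFun`). Its operator differs from the lifted operator by at most
the `L²` distance of the kernels, so a Gronwall argument
(`norm_sub_exp_smul_apply_le_of_perturbation`) gives the term `q^{αm}`. It needs a bound for the
lifted exponentials: the lifted operator acts as `A_ε` on the range of the isometry `T⁻¹` and
vanishes on the orthogonal complement (`norm_exp_smul_le_of_lift`), so surjectivity of `T⁻¹` is not
required.

The other claims follow by balancing `ε^β` with `q^{αm} = N_m^{-α/s}`. -/

theorem hasDerivWithinAt_exp_smul_apply (A : H →L[ℝ] H) (t : ℝ) {v : ℝ → H} {v' : H} {s : ℝ}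
    {I : Set ℝ} (hv : HasDerivWithinAt v v' I s) :
    HasDerivWithinAt (fun s => NormedSpace.exp ((t - s) • A) (v s))
      (NormedSpace.exp ((t - s) • A) (v' - A (v s))) I s := by
  have h1 := (hasDerivAt_exp_smul_const A (t - s)).scomp s ((hasDerivAt_id s).const_sub t)
  have h2 := (h1.hasDerivWithinAt (s := I)).clm_apply hv
  refine h2.congr_deriv ?_
  simp only [neg_smul, one_smul, neg_apply,
    mul_apply_eq_comp, map_sub, Function.comp_apply]
  abel

theorem continuousOn_exp_smul_apply (A : H →L[ℝ] H) (t : ℝ) {v : ℝ → H} {I : Set ℝ}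
    (hv : ContinuousOn v I) :
    ContinuousOn (fun s => NormedSpace.exp ((t - s) • A) (v s)) I := by
  have h : Continuous fun s : ℝ => NormedSpace.exp ((t - s) • A) :=
    (continuous_iff_continuousAt.2 fun s =>
      (hasDerivAt_exp_smul_const A s).continuousAt).comp (by fun_prop)
  exact h.continuousOn.clm_apply hv

/-- An approximate solution of `v' = A v` stays close to the exact one. -/
theorem norm_sub_exp_smul_apply_le (A : H →L[ℝ] H) {T M ρ : ℝ}
    (hM : ∀ s ∈ Icc 0 T, ‖NormedSpace.exp (s • A)‖ ≤ M) {v v' : ℝ → H}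
    (hv : ContinuousOn v (Icc 0 T))
    (hv' : ∀ s ∈ Ico 0 T, HasDerivWithinAt v (v' s) (Ici s) s)
    (hρ : ∀ s ∈ Ico 0 T, ‖v' s - A (v s)‖ ≤ ρ) {t : ℝ} (ht : t ∈ Icc 0 T) :
    ‖v t - NormedSpace.exp (t • A) (v 0)‖ ≤ M * ρ * t := by
  have hM0 : 0 ≤ M := (norm_nonneg _).trans (hM t ht)
  -- The path `s ↦ e^{(t-s)A} v(s)` runs from `e^{tA} v(0)` to `v(t)`, with velocity at most `M ρ`.
  have h := norm_image_sub_le_of_norm_deriv_right_le_segment (a := 0) (b := t) (C := M * ρ)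
    (continuousOn_exp_smul_apply A t (hv.mono (Icc_subset_Icc_right ht.2)))
    (fun s hs => hasDerivWithinAt_exp_smul_apply A t
      (hv' s ⟨hs.1, hs.2.trans_le ht.2⟩))
    (fun s hs => by
      refine (ContinuousLinearMap.le_opNorm _ _).trans
        (mul_le_mul (hM _ ⟨by linarith [hs.2], by linarith [hs.1, ht.2]⟩)
          (hρ s ⟨hs.1, hs.2.trans_le ht.2⟩) (norm_nonneg _) hM0)) t ⟨ht.1, le_rfl⟩
  simpa using h

/-- Stability of `v' = B v` under a bounded perturbation `B` of `A`. -/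
theorem norm_sub_exp_smul_apply_le_of_perturbation (A B : H →L[ℝ] H) {T M δ W : ℝ}
    (hM : ∀ s ∈ Icc 0 T, ‖NormedSpace.exp (s • A)‖ ≤ M) (hB : ‖B - A‖ ≤ δ) {x : H}
    (hW : ∀ s ∈ Icc 0 T, ‖NormedSpace.exp (s • A) x‖ ≤ W) {v : ℝ → H}
    (hv : ContinuousOn v (Icc 0 T))
    (hv' : ∀ s ∈ Ico 0 T, HasDerivWithinAt v (B (v s)) (Ici s) s) {t : ℝ} (ht : t ∈ Icc 0 T) :
    ‖v t - NormedSpace.exp (t • A) x‖ ≤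
      (M * ‖v 0 - x‖ + M * δ * W * T) * Real.exp (M * δ * T) := by
  have hT : 0 ≤ T := ht.1.trans ht.2
  have hM0 : 0 ≤ M := (norm_nonneg _).trans (hM t ht)
  have hW0 : 0 ≤ W := (norm_nonneg _).trans (hW t ht)
  have hδ0 : 0 ≤ δ := (norm_nonneg _).trans hB
  have hE : ∀ s, HasDerivAt (fun s : ℝ => NormedSpace.exp (s • A) x)
      (A (NormedSpace.exp (s • A) x)) s := fun s => by
    simpa using (hasDerivAt_exp_smul_const' A s).clm_apply (hasDerivAt_const s x)
  have hEc : Continuous fun s : ℝ => NormedSpace.exp (s • A) x :=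
    continuous_iff_continuousAt.2 fun s => (hE s).continuousAt
  set z : ℝ → H := fun s => v s - NormedSpace.exp (s • A) x with hz
  have hzc : ContinuousOn z (Icc 0 T) := hv.sub hEc.continuousOn
  have hz' : ∀ s ∈ Ico 0 T, HasDerivWithinAt z (B (v s) - A (NormedSpace.exp (s • A) x))
      (Ici s) s := fun s hs => (hv' s hs).sub (hE s).hasDerivWithinAt
  -- a continuous extension of the norm of the error
  set ζ : ℝ → ℝ := fun s => M * δ * (‖z (projIcc 0 T hT s)‖ + W) with hζ
  have hζc : Continuous ζ := by
    have : Continuous fun s => z (projIcc 0 T hT s) :=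
      (continuousOn_iff_continuous_domRestrict.1 hzc).comp continuous_projIcc
    exact continuous_const.mul (this.norm.add continuous_const)
  -- Duhamel bounds `‖z‖` by `R`, since the residual of `z` for `A` is `(B - A) v` and `‖v‖ ≤ ‖z‖ +
  -- W`. Then `R' = ζ ≤ M δ R + M δ W`, so Gronwall is applied to the differentiable majorant `R`
  -- instead of `‖z‖`.
  set R : ℝ → ℝ := fun s => M * ‖z 0‖ + ∫ r in (0 : ℝ)..s, ζ r with hR
  have hR' : ∀ s, HasDerivAt R (ζ s) s := fun s =>
    (intervalIntegral.integral_hasDerivAt_right (hζc.intervalIntegrable _ _)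
      (hζc.stronglyMeasurableAtFilter _ _) hζc.continuousAt).const_add _
  have hRc : Continuous R := continuous_iff_continuousAt.2 fun s => (hR' s).continuousAt
  have hproj : ∀ s ∈ Icc 0 T, ζ s = M * δ * (‖z s‖ + W) := fun s hs => by
    simp only [hζ, projIcc_of_mem hT hs]
  have hzR : ∀ s ∈ Icc 0 T, ‖z s‖ ≤ R s := by
    intro s hs
    have h := image_norm_le_of_norm_deriv_right_le_deriv_boundary' (a := 0) (b := s) (B := R)
      (B' := ζ) (continuousOn_exp_smul_apply A s (hzc.mono (Icc_subset_Icc_right hs.2)))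
      (fun r hr => hasDerivWithinAt_exp_smul_apply A s (hz' r ⟨hr.1, hr.2.trans_le hs.2⟩))
      (by
        simp only [hR, intervalIntegral.integral_same, add_zero, sub_zero]
        exact (ContinuousLinearMap.le_opNorm _ _).trans
          (mul_le_mul_of_nonneg_right (hM s hs) (norm_nonneg _)))
      hRc.continuousOn (fun r _ => (hR' r).hasDerivWithinAt)
      (fun r hr => by
        have hr' : r ∈ Icc 0 T := ⟨hr.1, hr.2.le.trans hs.2⟩
        rw [hproj r hr', mul_assoc]
        refine (ContinuousLinearMap.le_opNorm _ _).trans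
          (mul_le_mul (hM _ ⟨by linarith [hr.2], by linarith [hr.1, hs.2]⟩) ?_
            (norm_nonneg _) hM0)
        have : B (v r) - A (NormedSpace.exp (r • A) x) - A (z r) = (B - A) (v r) := by
          simp [hz]
        rw [this]
        refine (ContinuousLinearMap.le_opNorm _ _).trans
          (mul_le_mul hB ?_ (norm_nonneg _) hδ0)
        calc ‖v r‖ = ‖z r + NormedSpace.exp (r • A) x‖ := by simp [hz]
          _ ≤ ‖z r‖ + W := (norm_add_le _ _).trans (by gcongr; exact hW r hr'))
      ⟨hs.1, le_rfl⟩
    simpa using h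
  have hgr := le_gronwallBound_of_liminf_deriv_right_le (f := R) (f' := ζ) (δ := M * ‖z 0‖)
    (K := M * δ) (ε := M * δ * W) (a := 0) (b := T) hRc.continuousOn
    (fun s _ r hr => (hR' s).hasDerivWithinAt.liminf_right_slope_le hr)
    (by simp [hR])
    (fun s hs => by
      rw [hproj s ⟨hs.1, hs.2.le⟩, mul_add]
      gcongr
      exact hzR s ⟨hs.1, hs.2.le⟩) t ht
  refine (hzR t ht).trans (hgr.trans ?_)
  have hz0 : z 0 = v 0 - x := by simp [hz]
  rw [sub_zero, hz0]
  have hK : 0 ≤ M * δ := by positivity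
  rcases hK.eq_or_lt with hK | hK
  · rw [← hK, gronwallBound_K0]
    simp
  · rw [gronwallBound_of_K_ne_0 hK.ne', add_mul]
    have hexp : Real.exp (M * δ * t) ≤ Real.exp (M * δ * T) := by gcongr; exact ht.2
    refine add_le_add (by gcongr) ?_
    rw [mul_div_cancel_left₀ _ hK.ne']
    -- Dividing `M δ W` by the rate `M δ` has cancelled the small factor `δ`; this inequality, a
    -- form of `1 - y ≤ e^{-y}`, restores it.
    have hy : Real.exp (M * δ * T) - 1 ≤ M * δ * T * Real.exp (M * δ * T) := by
      have h1 := Real.add_one_le_exp (-(M * δ * T))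
      have h2 := mul_le_mul_of_nonneg_right h1 (Real.exp_pos (M * δ * T)).le
      rw [← Real.exp_add, neg_add_cancel, Real.exp_zero] at h2
      linarith
    calc W * (Real.exp (M * δ * t) - 1) ≤ W * (M * δ * T * Real.exp (M * δ * T)) := by
          gcongr; linarith
      _ = M * δ * W * T * Real.exp (M * δ * T) := by ring

end BoundedEvolution

/-! ### Orbits and generators of `C₀`-semigroups -/

namespace C0Semigroup

variable {H : Type*} [NormedAddCommGroup H] [NormedSpace ℝ H] (S : C0Semigroup H)

theorem op_add_apply (s t : ℝ≥0) (x : H) : S.op (s + t) x = S.op s (S.op t x) := by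
  rw [S.op_add]; rfl

theorem op_comm (s t : ℝ≥0) (x : H) : S.op s (S.op t x) = S.op t (S.op s x) := by
  rw [← op_add_apply, add_comm, op_add_apply]

/-- Otherwise there are times `t_j → 0` with `‖S(t_j)‖ > j`, although every sequence `S(t_j) x`
converges; this contradicts the uniform boundedness principle. -/
theorem exists_norm_le_of_le_pos [CompleteSpace H] :
    ∃ δ > 0, ∃ M : ℝ, ∀ t ≤ δ, ‖S.op t‖ ≤ M := by
  by_contra! h
  have hpos : ∀ j : ℕ, (0 : ℝ≥0) < 1 / (j + 1) := fun j => by positivity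
  choose t ht using fun j : ℕ => h (1 / (j + 1)) (hpos j) j
  have ht0 : Tendsto t atTop (𝓝 0) :=
    tendsto_of_tendsto_of_tendsto_of_le_of_le tendsto_const_nhds
      tendsto_one_div_add_atTop_nhds_zero_nat (fun _ => zero_le) (fun j => (ht j).1)
  obtain ⟨C, hC⟩ := banach_steinhaus (g := fun j => S.op (t j)) fun x => by
    obtain ⟨C, hC⟩ := (((S.tendsto_zero x).comp ht0).norm).bddAbove_range
    exact ⟨C, fun j => hC ⟨j, rfl⟩⟩
  obtain ⟨j, hj⟩ := exists_nat_gt C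
  linarith [hC j, (ht j).2]

theorem exists_norm_le [CompleteSpace H] (T : ℝ≥0) : ∃ M : ℝ, ∀ t ≤ T, ‖S.op t‖ ≤ M := by
  obtain ⟨δ, hδ, M, hM⟩ := S.exists_norm_le_of_le_pos
  have key : ∀ j : ℕ, ∃ C : ℝ, ∀ t ≤ j * δ, ‖S.op t‖ ≤ C := by
    intro j
    induction j with
    | zero => exact ⟨M, fun t ht => hM t (ht.trans (by simp))⟩
    | succ j ih =>
      obtain ⟨C, hC⟩ := ih
      refine ⟨max C (M * C), fun t ht => ?_⟩
      rcases le_total t (j * δ) with h | h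
      · exact (hC t h).trans (le_max_left _ _)
      · refine le_trans ?_ (le_max_right _ _)
        have hd : t - j * δ ≤ δ := by
          rw [tsub_le_iff_left]
          simpa [add_mul] using ht
        rw [← tsub_add_cancel_of_le h, S.op_add]
        exact (ContinuousLinearMap.opNorm_comp_le _ _).trans
          (mul_le_mul (hM _ hd) (hC _ le_rfl) (norm_nonneg _) ((norm_nonneg _).trans (hM _ hd)))
  obtain ⟨j, hj⟩ := exists_nat_ge (T / δ)
  obtain ⟨C, hC⟩ := key j
  exact ⟨C, fun t ht => hC t (ht.trans ((div_le_iff₀ hδ).1 hj))⟩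

theorem continuous_orbit [CompleteSpace H] (x : H) : Continuous fun t => S.op t x := by
  rw [continuous_iff_continuousAt]
  intro t
  obtain ⟨M, hM⟩ := S.exists_norm_le (t + 1)
  rw [ContinuousAt, tendsto_iff_norm_sub_tendsto_zero]
  -- Subtraction in `ℝ≥0` is truncated, so `s - t + (t - s)` is `|s - t|`. On either side of `t` the
  -- operator at the smaller time factors out, leaving `S(|s - t|) x - x`.
  have h1 : Tendsto (fun s => S.op (s - t + (t - s)) x - x) (𝓝 t) (𝓝 0) := by
    have : Tendsto (fun s : ℝ≥0 => s - t + (t - s)) (𝓝 t) (𝓝 0) := by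
      have : Continuous fun s : ℝ≥0 => s - t + (t - s) := by fun_prop
      simpa using this.tendsto t
    simpa using ((S.tendsto_zero x).comp this).sub_const x
  have h2 := h1.norm.const_mul M
  rw [norm_zero, mul_zero] at h2
  refine squeeze_zero' (Eventually.of_forall fun _ => norm_nonneg _) ?_ h2
  filter_upwards [eventually_le_nhds (show t < t + 1 by simp)] with s hs
  rcases le_total s t with h | h
  · rw [tsub_eq_zero_of_le h, zero_add]
    have : S.op t x = S.op s (S.op (t - s) x) := by
      rw [← op_add_apply, add_tsub_cancel_of_le h]
    rw [this, ← map_sub, norm_sub_rev]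
    exact (S.op s).le_of_opNorm_le (hM s hs) _
  · rw [tsub_eq_zero_of_le h, add_zero]
    have : S.op s x = S.op t (S.op (s - t) x) := by
      rw [← op_add_apply, add_tsub_cancel_of_le h]
    rw [this, ← map_sub]
    exact (S.op t).le_of_opNorm_le (hM t (by simp)) _

variable {S} {A : H →ₗ.[ℝ] H}

theorem IsGenerator.op_mem_graph (hS : S.IsGenerator A) {x y : H} (h : (x, y) ∈ A.graph)
    (t : ℝ≥0) : (S.op t x, S.op t y) ∈ A.graph := by
  rw [hS] at h ⊢
  refine (((S.op t).continuous.tendsto y).comp h).congr fun s => ?_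
  simp only [Function.comp_apply, map_smul, map_sub]
  rw [op_comm]

/-- Right differentiability of an orbit at a time when it is in the domain of the generator. -/
theorem IsGenerator.hasDerivWithinAt_orbit (hS : S.IsGenerator A) {x y : H} {t : ℝ} (ht : 0 ≤ t)
    (h : (S.op t.toNNReal x, y) ∈ A.graph) :
    HasDerivWithinAt (fun s : ℝ => S.op s.toNNReal x) y (Ici t) t := by
  rw [← hasDerivWithinAt_Ioi_iff_Ici, hasDerivWithinAt_iff_tendsto_slope' self_notMem_Ioi]
  rw [hS] at h
  have hlim : Tendsto (fun s : ℝ => (s - t).toNNReal) (𝓝[>] t) (𝓝[>] 0) := by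
    refine tendsto_nhdsWithin_iff.2 ⟨?_, ?_⟩
    · have : Continuous fun s : ℝ => (s - t).toNNReal := by fun_prop
      simpa using (this.tendsto t).mono_left nhdsWithin_le_nhds
    · filter_upwards [self_mem_nhdsWithin] with s hs
      simpa using hs
  refine (h.comp hlim).congr' ?_
  filter_upwards [self_mem_nhdsWithin] with s hs
  have hs' : t < s := hs
  rw [Function.comp_apply, slope_def_module, Real.coe_toNNReal _ (by linarith),
    ← op_add_apply, ← Real.toNNReal_add (by linarith) ht, sub_add_cancel]

/-- The generator of a `C₀`-semigroup is closed. -/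
theorem IsGenerator.isClosed [CompleteSpace H] (hS : S.IsGenerator A) {x y : ℕ → H} {x₀ y₀ : H}
    (hxy : ∀ j, (x j, y j) ∈ A.graph) (hx : Tendsto x atTop (𝓝 x₀))
    (hy : Tendsto y atTop (𝓝 y₀)) : (x₀, y₀) ∈ A.graph := by
  obtain ⟨M, hM⟩ := S.exists_norm_le 1
  have hM0 : 0 ≤ M := (norm_nonneg _).trans (hM 0 zero_le)
  rw [hS, Metric.tendsto_nhds]
  intro η hη
  obtain ⟨δ, hδ, hδ'⟩ := Metric.eventually_nhds_iff.1 (Metric.tendsto_nhds.1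
    (S.tendsto_zero y₀) (η / 2) (by positivity))
  have hsmall : ∀ᶠ t : ℝ≥0 in 𝓝[>] 0, t < min δ.toNNReal 1 :=
    nhdsWithin_le_nhds (eventually_lt_nhds (by simpa using hδ))
  filter_upwards [hsmall, self_mem_nhdsWithin] with t ht htpos
  have ht0 : (0 : ℝ) < t := htpos
  rw [lt_min_iff] at ht
  -- The mean value inequality is applied to `s ↦ S(s) x_j - s y₀`, with right derivative `S(s) y_j
  -- - y₀`. The bound is proportional to `t`, with coefficient tending to `η / 2` as `j → ∞`, so the
  -- limit in `j` can be taken at fixed `t`.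
  have hj : ∀ j, ‖S.op t (x j) - x j - (t : ℝ) • y₀‖ ≤ (M * ‖y j - y₀‖ + η / 2) * t := by
    intro j
    have h := norm_image_sub_le_of_norm_deriv_right_le_segment (a := 0) (b := (t : ℝ))
      (f := fun s : ℝ => S.op s.toNNReal (x j) - s • y₀)
      (f' := fun s => S.op s.toNNReal (y j) - y₀) (C := M * ‖y j - y₀‖ + η / 2)
      (((S.continuous_orbit (x j)).comp continuous_real_toNNReal).sub
        (by fun_prop)).continuousOn
      (fun s hs => (hS.hasDerivWithinAt_orbit hs.1 (hS.op_mem_graph (hxy j) _)).sub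
        (by simpa using ((hasDerivAt_id s).smul_const y₀).hasDerivWithinAt))
      (fun s hs => by
        have hst : s.toNNReal < t := by
          rw [Real.toNNReal_lt_iff_lt_coe hs.1]; exact hs.2
        have e : S.op s.toNNReal (y j) - y₀ =
            S.op s.toNNReal (y j - y₀) + (S.op s.toNNReal y₀ - y₀) := by
          rw [map_sub]; abel
        rw [e]
        refine (norm_add_le _ _).trans (add_le_add ?_ ?_)
        · exact (S.op _).le_of_opNorm_le (hM _ (hst.trans ht.2).le) _
        · rw [← dist_eq_norm]
          refine (hδ' ?_).le
          rw [NNReal.dist_eq, NNReal.coe_zero, sub_zero, abs_of_nonneg (NNReal.coe_nonneg _)]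
          have := hst.trans ht.1
          rwa [← NNReal.coe_lt_coe, Real.coe_toNNReal δ hδ.le] at this)
      t ⟨ht0.le, le_rfl⟩
    have e : S.op t (x j) - x j - (t : ℝ) • y₀ =
        S.op t (x j) - (t : ℝ) • y₀ - x j := by abel
    simpa [S.op_zero, e] using h
  have hlim1 : Tendsto (fun j => ‖S.op t (x j) - x j - (t : ℝ) • y₀‖) atTop
      (𝓝 ‖S.op t x₀ - x₀ - (t : ℝ) • y₀‖) :=
    (((((S.op t).continuous.tendsto x₀).comp hx).sub hx).sub_const _).norm
  have hlim2 : Tendsto (fun j => (M * ‖y j - y₀‖ + η / 2) * t) atTop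
      (𝓝 ((M * ‖y₀ - y₀‖ + η / 2) * t)) :=
    ((((hy.sub_const y₀).norm).const_mul M).add_const _).mul_const _
  have hfin := le_of_tendsto_of_tendsto' hlim1 hlim2 hj
  rw [sub_self, norm_zero, mul_zero, zero_add] at hfin
  have e : (t : ℝ)⁻¹ • (S.op t x₀ - x₀) - y₀ =
      (t : ℝ)⁻¹ • (S.op t x₀ - x₀ - (t : ℝ) • y₀) := by
    rw [smul_sub _ (_ - _), inv_smul_smul₀ ht0.ne']
  rw [dist_eq_norm, e, norm_smul, norm_inv, Real.norm_eq_abs, abs_of_pos ht0,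
    inv_mul_lt_iff₀ ht0]
  nlinarith

/-- A `C₀`-semigroup generated by a bounded operator is the exponential semigroup. -/
theorem IsGenerator.op_eq_exp [CompleteSpace H] {B : H →L[ℝ] H}
    (hS : S.IsGenerator ((B : H →ₗ[ℝ] H).toPMap ⊤)) (t : ℝ≥0) :
    S.op t = NormedSpace.exp ((t : ℝ) • B) := by
  ext x
  have hcont : Continuous fun s : ℝ => NormedSpace.exp (s • B) :=
    continuous_iff_continuousAt.2 fun s => (hasDerivAt_exp_smul_const B s).continuousAt
  obtain ⟨M, hM⟩ := (isCompact_Icc (a := (0 : ℝ)) (b := t)).exists_bound_of_continuousOn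
    hcont.continuousOn
  -- The orbit solves `v' = B v` with zero residual, hence coincides with the exponential.
  have h := norm_sub_exp_smul_apply_le B (T := t) (ρ := 0) hM
    (v := fun s : ℝ => S.op s.toNNReal x) (v' := fun s => B (S.op s.toNNReal x))
    ((S.continuous_orbit x).comp continuous_real_toNNReal).continuousOn
    (fun s hs => hS.hasDerivWithinAt_orbit hs.1 (by simp [LinearPMap.mem_graph_iff]))
    (fun s _ => by simp) (t := t) ⟨t.2, le_rfl⟩
  simpa [S.op_zero, sub_eq_zero] using h

end C0Semigroup

/-! ### Convergence of the stable and consistent nonlocal approximations -/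

namespace StableConsistent

variable {H X : Type*} [NormedAddCommGroup H] [NormedSpace ℝ H] [CompleteSpace H]
  [NormedAddCommGroup X] [NormedSpace ℝ X] {ι : X →L[ℝ] H} {A : H →ₗ.[ℝ] H}
  {Aε : ℝ → H →L[ℝ] H} {r : ℝ → ℝ}

/-- The semigroup in the stability hypothesis is the exponential by `op_eq_exp`. Absolute values
cover negative growth rates and keep the bound at least 1. -/
theorem exists_norm_exp_le (h : StableConsistent ι A Aε r) (T : ℝ) :
    ∃ M : ℝ, 1 ≤ M ∧ ∀ ε, 0 < ε → ∀ t ∈ Icc 0 T, ‖NormedSpace.exp (t • Aε ε)‖ ≤ M := by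
  obtain ⟨M, ω, hM, hS⟩ := h.stable
  refine ⟨M * Real.exp (|ω| * |T|), ?_, fun ε hε t ht => ?_⟩
  · exact one_le_mul_of_one_le_of_one_le hM (Real.one_le_exp (by positivity))
  · obtain ⟨S, hg, hb⟩ := hS ε hε
    have h1 := hb t.toNNReal
    rw [hg.op_eq_exp, Real.coe_toNNReal _ ht.1] at h1
    refine h1.trans ?_
    gcongr
    · exact ht.1
    · exact le_abs_self ω
    · exact ht.2.trans (le_abs_self T)

/-- The consistency estimate extends from the core to the whole regularity space. -/
theorem norm_sub_le (h : StableConsistent ι A Aε r) {S : C0Semigroup H} (hS : S.IsGenerator A)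
    {ε : ℝ} (hε : 0 < ε) {φ : X} {y : H} (hy : (ι φ, y) ∈ A.graph) :
    ‖Aε ε (ι φ) - y‖ ≤ r ε * ‖φ‖ := by
  obtain ⟨D₀, hD, hcore, hcons⟩ := h.consistent
  have hdom : ∀ ψ ∈ D₀, ι ψ ∈ A.domain := fun ψ hψ => hcore.le_domain ⟨ψ, hψ, rfl⟩
  obtain ⟨ψ, hψD, hψ⟩ := mem_closure_iff_seq_limit.1 (hD φ)
  set a : ℕ → H := fun j => A ⟨ι (ψ j), hdom _ (hψD j)⟩ with ha
  have hιψ : Tendsto (fun j => ι (ψ j)) atTop (𝓝 (ι φ)) := (ι.continuous.tendsto φ).comp hψ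
  -- At fixed `ε` the norm of `Aε ε` is harmless: it serves only to make `A ψ_j` a Cauchy sequence
  -- and drops out of the final bound. Closedness of `A` then identifies the limit with `y`.
  have hdiff : ∀ i j, ‖a i - a j‖ ≤ (‖Aε ε‖ * ‖ι‖ + r ε) * ‖ψ i - ψ j‖ := by
    intro i j
    have hmem := D₀.sub_mem (hψD i) (hψD j)
    have h1 := hcons ε hε _ hmem (hdom _ hmem)
    have h2 : A ⟨ι (ψ i - ψ j), hdom _ hmem⟩ = a i - a j := by
      simp only [ha, ← LinearPMap.map_sub]
      congr 1
      ext
      simp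
    rw [h2] at h1
    have e : a i - a j = Aε ε (ι (ψ i - ψ j)) - (Aε ε (ι (ψ i - ψ j)) - (a i - a j)) := by abel
    calc ‖a i - a j‖ ≤ ‖Aε ε (ι (ψ i - ψ j))‖ + ‖Aε ε (ι (ψ i - ψ j)) - (a i - a j)‖ := by
          conv_lhs => rw [e]
          exact _root_.norm_sub_le _ _
      _ ≤ ‖Aε ε‖ * (‖ι‖ * ‖ψ i - ψ j‖) + r ε * ‖ψ i - ψ j‖ :=
          add_le_add ((Aε ε).le_opNorm_of_le (ι.le_opNorm _)) h1
      _ = _ := by ring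
  have hcau : CauchySeq a := by
    have hψc := hψ.cauchySeq
    rw [cauchySeq_iff_tendsto_dist_atTop_0] at hψc ⊢
    have h0 := hψc.const_mul (‖Aε ε‖ * ‖ι‖ + r ε)
    rw [mul_zero] at h0
    refine squeeze_zero (fun _ => dist_nonneg) (fun ij => ?_) h0
    rw [dist_eq_norm, dist_eq_norm]
    exact hdiff _ _
  obtain ⟨y', hy'⟩ := cauchySeq_tendsto_of_complete hcau
  have hgr : (ι φ, y') ∈ A.graph :=
    hS.isClosed (fun j => A.mem_graph ⟨ι (ψ j), hdom _ (hψD j)⟩) hιψ hy'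
  have hyy : y = y' := A.mem_graph_snd_inj hy hgr rfl
  rw [hyy]
  exact le_of_tendsto_of_tendsto'
    ((((Aε ε).continuous.tendsto _).comp hιψ).sub hy').norm (hψ.norm.const_mul (r ε))
    (fun j => hcons ε hε _ (hψD j) (hdom _ (hψD j)))

/-- Distance between the evolution of the bounded approximation and the reference evolution. -/
theorem norm_exp_sub_orbit_le (h : StableConsistent ι A Aε r) {S : C0Semigroup H}
    (hS : S.IsGenerator A) (hXA : ∀ x, ι x ∈ A.domain) {T M B ε : ℝ} (hε : 0 < ε)
    (hM : ∀ t ∈ Icc 0 T, ‖NormedSpace.exp (t • Aε ε)‖ ≤ M) {x : H}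
    (hreg : ∀ t : ℝ≥0, (t : ℝ) ≤ T → ∃ φ : X, ι φ = S.op t x ∧ ‖φ‖ ≤ B) {R : ℝ}
    (hR0 : 0 ≤ R) (hR : r ε ≤ R) {t : ℝ≥0} (ht : (t : ℝ) ≤ T) :
    ‖S.op t x - NormedSpace.exp ((t : ℝ) • Aε ε) x‖ ≤ M * (R * B) * t := by
  choose! φ hφ hφB using hreg
  -- The orbit of `S` is treated as an approximate solution of `v' = A_ε v`, with residual `(A -
  -- A_ε) u(s)`.
  have h1 := norm_sub_exp_smul_apply_le (Aε ε) (ρ := R * B) hM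
    (v := fun s : ℝ => S.op s.toNNReal x)
    (v' := fun s => A ⟨ι (φ s.toNNReal), hXA _⟩)
    ((S.continuous_orbit x).comp continuous_real_toNNReal).continuousOn
    (fun s hs => by
      have hs' : ((s.toNNReal : ℝ≥0) : ℝ) ≤ T := by rw [Real.coe_toNNReal _ hs.1]; exact hs.2.le
      refine hS.hasDerivWithinAt_orbit hs.1 ?_
      rw [← hφ _ hs']
      exact A.mem_graph ⟨ι (φ s.toNNReal), hXA _⟩)
    (fun s hs => by
      have hs' : ((s.toNNReal : ℝ≥0) : ℝ) ≤ T := by rw [Real.coe_toNNReal _ hs.1]; exact hs.2.le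
      rw [← hφ _ hs', norm_sub_rev]
      refine (h.norm_sub_le hS hε (A.mem_graph ⟨ι (φ s.toNNReal), hXA _⟩)).trans ?_
      exact mul_le_mul hR (hφB _ hs') (norm_nonneg _) hR0) (t := t) ⟨t.2, ht⟩
  simpa [S.op_zero] using h1

end StableConsistent

/-! ### Integral operators and their transport along measure-preserving maps -/

section Kernel

variable {V : Type*} [MeasurableSpace V] {μ : Measure V} [IsProbabilityMeasure μ] {n : ℕ}

/-- The Hilbert–Schmidt bound, which turns `L²` distances of kernels into operator perturbations. -/
theorem norm_kernelOp_le (κ : L2Kernel n μ) : ‖kernelOp κ‖ ≤ ‖κ‖ :=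
  LinearMap.mkContinuous_norm_le _ (norm_nonneg _) _

theorem kernelOp_add (κ₁ κ₂ : L2Kernel n μ) : kernelOp (κ₁ + κ₂) = kernelOp κ₁ + kernelOp κ₂ := by
  ext1 u
  rw [add_apply]
  refine Lp.ext ?_
  filter_upwards [kernelOp_coeFn (κ₁ + κ₂) u, kernelOp_coeFn κ₁ u, kernelOp_coeFn κ₂ u,
    Lp.coeFn_add (kernelOp κ₁ u) (kernelOp κ₂ u), integrable_kernel κ₁ u, integrable_kernel κ₂ u,
    Measure.ae_ae_of_ae_prod (Lp.coeFn_add κ₁ κ₂)] with x h h₁ h₂ hs i₁ i₂ hx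
  rw [h, hs, Pi.add_apply, h₁, h₂, ← integral_add i₁ i₂]
  refine integral_congr_ae ?_
  filter_upwards [hx] with y hy
  rw [hy, Pi.add_apply, add_apply]

/-- `kernelOp` as an additive homomorphism in the kernel. -/
noncomputable def kernelOpHom (n : ℕ) (μ : Measure V) [IsProbabilityMeasure μ] :
    L2Kernel n μ →+ (L2 n μ →L[ℝ] L2 n μ) :=
  AddMonoidHom.mk' kernelOp kernelOp_add

theorem kernelOp_sub (κ₁ κ₂ : L2Kernel n μ) : kernelOp (κ₁ - κ₂) = kernelOp κ₁ - kernelOp κ₂ :=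
  map_sub (kernelOpHom n μ) κ₁ κ₂

theorem kernelOp_sum {ι : Type*} (s : Finset ι) (κ : ι → L2Kernel n μ) :
    kernelOp (∑ i ∈ s, κ i) = ∑ i ∈ s, kernelOp (κ i) :=
  map_sum (kernelOpHom n μ) κ s

theorem kernelOp_indicatorConstLp {s t : Set V} (hs : MeasurableSet s) (ht : MeasurableSet t)
    (a : EuclideanSpace ℝ (Fin n) →L[ℝ] EuclideanSpace ℝ (Fin n)) (u : L2 n μ) :
    kernelOp (indicatorConstLp 2 (hs.prod ht) (measure_ne_top (μ.prod μ) _) a) u =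
      indicatorConstLp 2 hs (measure_ne_top μ _) (a (∫ y in t, u y ∂μ)) := by
  refine Lp.ext ?_
  filter_upwards [kernelOp_coeFn (indicatorConstLp 2 (hs.prod ht) (measure_ne_top (μ.prod μ) _) a) u,
    indicatorConstLp_coeFn (p := 2) (hs := hs) (hμs := measure_ne_top μ _)
      (c := a (∫ y in t, u y ∂μ)),
    Measure.ae_ae_of_ae_prod (indicatorConstLp_coeFn (p := 2) (hs := hs.prod ht)
      (hμs := measure_ne_top (μ.prod μ) _) (c := a))] with x h1 h2 h3
  have hu : Integrable u μ := (Lp.memLp u).integrable one_le_two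
  rw [h1, h2]
  by_cases hx : x ∈ s
  · rw [indicator_of_mem hx, ← a.integral_comp_comm hu.integrableOn, ← integral_indicator ht]
    refine integral_congr_ae ?_
    filter_upwards [h3] with y hy
    rw [hy]
    by_cases hyt : y ∈ t <;> simp [hx, hyt]
  · rw [indicator_of_notMem hx]
    refine integral_eq_zero_of_ae ?_
    filter_upwards [h3] with y hy
    rw [hy]
    simp [hx]

/-- By Fubini; it allows rows of the kernel to serve as `L²` test functions. -/
theorem ae_memLp_kernel_slice (κ : L2Kernel n μ) : ∀ᵐ x ∂μ, MemLp (fun y => κ (x, y)) 2 μ := by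
  have hκ : Measurable fun z => ‖κ z‖ₑ := (Lp.stronglyMeasurable κ).enorm
  have hfin : (∫⁻ x, ∫⁻ y, ‖κ (x, y)‖ₑ ^ (2 : ℝ) ∂μ ∂μ) ≠ ∞ := by
    rw [← lintegral_prod (fun z => ‖κ z‖ₑ ^ (2 : ℝ)) (by fun_prop), lintegral_sq_eq]
    exact ENNReal.rpow_ne_top_of_nonneg (by norm_num) (Lp.eLpNorm_lt_top κ).ne
  filter_upwards [ae_lt_top (by fun_prop) hfin] with x hx
  refine ⟨((Lp.stronglyMeasurable κ).comp_measurable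
    measurable_prodMk_left).aestronglyMeasurable, ?_⟩
  rw [lintegral_sq_eq (fun y => κ (x, y))] at hx
  by_contra htop
  rw [not_lt, top_le_iff] at htop
  rw [htop] at hx
  simp at hx

variable {W : Type*} [MeasurableSpace W] {ν : Measure W} [IsProbabilityMeasure ν] {φ : V → W}

theorem coeFn_compMeasurePreserving_kernel (hφ : MeasurePreserving φ μ ν) (κ : L2Kernel n ν) :
    ∀ᵐ x ∂μ, ∀ᵐ y ∂μ,
      Lp.compMeasurePreserving _ (hφ.prod hφ) κ (x, y) = κ (φ x, φ y) :=
  Measure.ae_ae_of_ae_prod (Lp.coeFn_compMeasurePreserving κ (hφ.prod hφ))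

theorem kernelOp_compMeasurePreserving (hφ : MeasurePreserving φ μ ν) (κ : L2Kernel n ν)
    (u : L2 n ν) :
    kernelOp (Lp.compMeasurePreserving _ (hφ.prod hφ) κ) (Lp.compMeasurePreserving φ hφ u) =
      Lp.compMeasurePreserving φ hφ (kernelOp κ u) := by
  refine Lp.ext ?_
  filter_upwards [kernelOp_coeFn (Lp.compMeasurePreserving _ (hφ.prod hφ) κ)
      (Lp.compMeasurePreserving φ hφ u), Lp.coeFn_compMeasurePreserving (kernelOp κ u) hφ,
    hφ.quasiMeasurePreserving.ae (kernelOp_coeFn κ u),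
    coeFn_compMeasurePreserving_kernel hφ κ] with x h1 h2 h3 h4
  rw [h1, h2, Function.comp_apply, h3]
  have hm : StronglyMeasurable fun y => κ (φ x, y) (u y) :=
    isBoundedBilinearMap_apply.continuous.comp_stronglyMeasurable
      (((Lp.stronglyMeasurable κ).comp_measurable measurable_prodMk_left).prodMk
        (Lp.stronglyMeasurable u))
  have hmap := integral_map hφ.aemeasurable hm.aestronglyMeasurable
  rw [hφ.map_eq] at hmap
  rw [hmap]
  refine integral_congr_ae ?_
  filter_upwards [h4, Lp.coeFn_compMeasurePreserving u hφ] with y hy hu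
  rw [hy, hu, Function.comp_apply]

/-- A lifted kernel annihilates the functions orthogonal to the lifted functions. -/
theorem kernelOp_compMeasurePreserving_eq_zero (hφ : MeasurePreserving φ μ ν) (κ : L2Kernel n ν)
    {z : L2 n μ} (hz : ∀ g : L2 n ν, inner ℝ (Lp.compMeasurePreserving φ hφ g) z = 0) :
    kernelOp (Lp.compMeasurePreserving _ (hφ.prod hφ) κ) z = 0 := by
  refine Lp.ext ?_
  filter_upwards [kernelOp_coeFn (Lp.compMeasurePreserving _ (hφ.prod hφ) κ) z,
    Lp.coeFn_zero (EuclideanSpace ℝ (Fin n)) 2 μ,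
    integrable_kernel (Lp.compMeasurePreserving _ (hφ.prod hφ) κ) z,
    hφ.quasiMeasurePreserving.ae (ae_memLp_kernel_slice κ),
    coeFn_compMeasurePreserving_kernel hφ κ] with x h1 h2 h3 h4 h5
  rw [h1, h2, Pi.zero_apply]
  refine ext_inner_left ℝ fun e => ?_
  rw [← integral_inner h3, inner_zero_right]
  -- Paired with `e`, the integral becomes the inner product of `z` with `y ↦ κ(φ x, φ y)* e`. This
  -- is a lifted function, hence orthogonal to `z`.
  have hadj : MemLp (fun y => ContinuousLinearMap.adjoint (κ (φ x, y)) e) 2 ν := by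
    refine MemLp.of_le_mul (c := ‖e‖) h4 ?_ (Eventually.of_forall fun y => ?_)
    · exact ((ContinuousLinearMap.adjoint (𝕜 := ℝ) (E := EuclideanSpace ℝ (Fin n))
        (F := EuclideanSpace ℝ (Fin n))).continuous.clm_apply
          continuous_const).comp_aestronglyMeasurable h4.1
    · refine (ContinuousLinearMap.le_opNorm _ _).trans (le_of_eq ?_)
      rw [LinearIsometryEquiv.norm_map, mul_comm]
  rw [← hz (hadj.toLp _), L2.inner_def]
  refine integral_congr_ae ?_
  filter_upwards [h5, Lp.coeFn_compMeasurePreserving (hadj.toLp _) hφ,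
    hφ.quasiMeasurePreserving.ae hadj.coeFn_toLp] with y hy hy1 hy2
  rw [hy, hy1, Function.comp_apply, hy2, ContinuousLinearMap.adjoint_inner_left]

end Kernel

/-! ### Exponentials of lifted operators -/

section LiftedExponential

variable {H G : Type*} [NormedAddCommGroup H] [InnerProductSpace ℝ H] [CompleteSpace H]
  [NormedAddCommGroup G] [InnerProductSpace ℝ G] [CompleteSpace G]

/-- The path `s ↦ e^{(t-s)B} J e^{sA} x` has derivative `e^{(t-s)B} (J A - B J) e^{sA} x = 0`, and
its values at `0` and `t` are the two sides. -/
theorem exp_smul_intertwine {J : H →L[ℝ] G} {A : H →L[ℝ] H} {B : G →L[ℝ] G}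
    (hJ : ∀ x, B (J x) = J (A x)) (t : ℝ) (x : H) :
    NormedSpace.exp (t • B) (J x) = J (NormedSpace.exp (t • A) x) := by
  have hd : ∀ s, HasDerivAt (fun s : ℝ => NormedSpace.exp ((t - s) • B)
      (J (NormedSpace.exp (s • A) x))) 0 s := fun s => by
    have h1 : HasDerivAt (fun s : ℝ => NormedSpace.exp (s • A) x)
        (A (NormedSpace.exp (s • A) x)) s := by
      simpa using (hasDerivAt_exp_smul_const' A s).clm_apply (hasDerivAt_const s x)
    have h2 := hasDerivWithinAt_exp_smul_apply B t
      (J.hasFDerivAt.comp_hasDerivAt s h1).hasDerivWithinAt (I := univ)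
    rw [hasDerivWithinAt_univ] at h2
    simpa [hJ] using h2
  have h := is_const_of_deriv_eq_zero (fun s => (hd s).differentiableAt)
    (fun s => (hd s).deriv) 0 t
  simpa using h

/-- If `B` acts as `A` on the image of the isometry `J` and vanishes on its orthogonal complement,
then the exponentials of `B` are controlled by those of `A`. -/
theorem norm_exp_smul_le_of_lift (J : H →ₗᵢ[ℝ] G) {A : H →L[ℝ] H} {B : G →L[ℝ] G}
    (hJ : ∀ x, B (J x) = J (A x)) (hB : ∀ z, (∀ g, inner ℝ (J g) z = 0) → B z = 0) (t : ℝ) :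
    ‖NormedSpace.exp (t • B)‖ ≤ ‖NormedSpace.exp (t • A)‖ + 2 := by
  refine ContinuousLinearMap.opNorm_le_bound _ (by positivity) fun z => ?_
  set x : H := ContinuousLinearMap.adjoint J.toContinuousLinearMap z with hx
  have hxz : ‖x‖ ≤ ‖z‖ := by
    refine (ContinuousLinearMap.le_opNorm _ _).trans ?_
    rw [LinearIsometryEquiv.norm_map]
    exact mul_le_of_le_one_left (norm_nonneg _) J.norm_toContinuousLinearMap_le
  set y : G := z - J x with hy
  have hy0 : B y = 0 := hB y fun g => by
    have : inner ℝ (J g) z = inner ℝ g x := by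
      rw [hx, ContinuousLinearMap.adjoint_inner_right]; rfl
    rw [hy, inner_sub_right, this, J.inner_map_map, sub_self]
  -- Since `B y = 0`, the map `a ↦ a y` from `ℝ` intertwines `B` with the zero operator.
  have hexp : NormedSpace.exp (t • B) y = y := by
    have h := exp_smul_intertwine (J := (ContinuousLinearMap.id ℝ ℝ).smulRight y)
      (A := 0) (B := B) (fun a => by simp [hy0]) t 1
    simpa using h
  have hz : z = J x + y := by simp [hy]
  -- The triangle inequality suffices and is the source of the constant 2; only uniformity in `ε`
  -- matters.
  have hyz : ‖y‖ ≤ 2 * ‖z‖ := by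
    refine (norm_sub_le _ _).trans ?_
    rw [J.norm_map]; linarith
  have hJx : NormedSpace.exp (t • B) (J x) = J (NormedSpace.exp (t • A) x) :=
    exp_smul_intertwine (J := J.toContinuousLinearMap) hJ t x
  calc ‖NormedSpace.exp (t • B) z‖ = ‖J (NormedSpace.exp (t • A) x) + y‖ := by
        conv_lhs => rw [hz, map_add, hJx, hexp]
    _ ≤ ‖NormedSpace.exp (t • A)‖ * ‖x‖ + ‖y‖ := by
        refine (norm_add_le _ _).trans ?_
        rw [J.norm_map]
        gcongr
        exact ContinuousLinearMap.le_opNorm _ _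
    _ ≤ ‖NormedSpace.exp (t • A)‖ * ‖z‖ + 2 * ‖z‖ := by gcongr
    _ = _ := by ring

end LiftedExponential

/-! ### Cells and codes -/

namespace SelfSimilarSet

section Codes

variable {k : ℕ} {V : Type*} [MetricSpace V] (F : SelfSimilarSet k V)

/-- The diameters of nested cells tend to zero, so their intersection is one point and the choice
made in `coding` is immaterial. -/
theorem coding_eq_of_mem_cell {w : ℕ → Fin k} {x : V}
    (hx : ∀ m, x ∈ F.cell (fun i : Fin m => w i)) : F.coding w = x := by
  obtain ⟨ρ, h0, h1, hρ⟩ := F.exists_ratio_bound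
  have hlim : Tendsto (fun m : ℕ => ρ ^ m * Metric.diam F.carrier) atTop (𝓝 0) := by
    simpa using (tendsto_pow_atTop_nhds_zero_of_lt_one h0.le h1).mul_const
      (Metric.diam F.carrier)
  refine dist_le_zero.1 (ge_of_tendsto' hlim fun m => ?_)
  obtain ⟨a, ha, haw⟩ := F.coding_mem w m
  obtain ⟨b, hb, hbw⟩ := hx m
  rw [← haw, ← hbw]
  exact (F.dist_wordMap_le h0 hρ m _ a b).trans (mul_le_mul_of_nonneg_left
    (Metric.dist_le_diam_of_mem F.isCompact_carrier.isBounded ha hb) (pow_nonneg h0.le m))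

theorem coding_cons (i : Fin k) (w : ℕ → Fin k) :
    F.coding (fun j => Nat.casesOn j i w) = F.map i (F.coding w) := by
  refine F.coding_eq_of_mem_cell fun m => ?_
  obtain _ | m := m
  · obtain ⟨x, hx, hxw⟩ := F.coding_mem w 0
    exact ⟨F.map i x, F.map_carrier_subset i ⟨x, hx, rfl⟩, by rw [← hxw]; rfl⟩
  · obtain ⟨x, hx, hxw⟩ := F.coding_mem w m
    exact ⟨x, hx, by rw [← hxw]; rfl⟩

/-- Each point `y` of the attractor is `f_i(z)` for some digit `i` and some `z` in the attractor;
iterating `y ↦ z` reads off the digits of a code. -/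
theorem exists_coding_eq {x : V} (hx : x ∈ F.carrier) : ∃ w, F.coding w = x := by
  have h : ∀ y : F.carrier, ∃ i, ∃ z : F.carrier, F.map i z = y := by
    rintro ⟨y, hy⟩
    rw [F.carrier_eq] at hy
    obtain ⟨i, z, hz, rfl⟩ := mem_iUnion.1 hy
    exact ⟨i, ⟨z, hz⟩, rfl⟩
  choose i z hz using h
  have key : ∀ (m : ℕ) (y : F.carrier),
      (y : V) ∈ F.cell (fun j : Fin m => i (z^[j] y)) := by
    intro m
    induction m with
    | zero => exact fun y => ⟨y, y.2, rfl⟩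
    | succ m ih =>
      intro y
      obtain ⟨a, ha, hay⟩ := ih (z y)
      refine ⟨a, ha, ?_⟩
      change F.map (i y) (F.wordMap m (fun j : Fin m => i (z^[j] (z y))) a) = y
      rw [hay, hz]
  exact ⟨fun j => i (z^[j] ⟨x, hx⟩), F.coding_eq_of_mem_cell fun m => key m ⟨x, hx⟩⟩

theorem exists_coding_eq_of_mem_cell : ∀ (m : ℕ) (w : Fin m → Fin k) {x : V}, x ∈ F.cell w →
    ∃ v : ℕ → Fin k, (∀ i : Fin m, v i = w i) ∧ F.coding v = x
  | 0, w, x, ⟨y, hy, hyx⟩ => by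
      obtain ⟨v, hv⟩ := F.exists_coding_eq hy
      exact ⟨v, fun i => i.elim0, hv.trans hyx⟩
  | m + 1, w, x, ⟨y, hy, hyx⟩ => by
      obtain ⟨v, hv, hvx⟩ := exists_coding_eq_of_mem_cell m (Fin.tail w) ⟨y, hy, rfl⟩
      refine ⟨fun j => Nat.casesOn j (w 0) v, fun i => ?_, ?_⟩
      · refine Fin.cases rfl (fun j => ?_) i
        exact hv j
      · rw [coding_cons, hvx]
        exact hyx

/-- Every point of `K_v` has a code beginning with `v`; when the code is unique, it must be `w`. -/
theorem coding_mem_cell_iff {m : ℕ} {w : ℕ → Fin k} (hw : w ∉ F.multiCoded)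
    (v : Fin m → Fin k) : F.coding w ∈ F.cell v ↔ (fun i : Fin m => w i) = v := by
  refine ⟨fun h => ?_, fun h => h ▸ F.coding_mem w m⟩
  obtain ⟨w', hw', he⟩ := F.exists_coding_eq_of_mem_cell m v h
  have : w' = w := by
    by_contra hne
    exact hw ⟨w', hne, he⟩
  exact funext fun i => this ▸ hw' i

end Codes

/-! ### The particle system as the evolution equation of the step kernel -/

section Galerkin

variable {k : ℕ} {V : Type*} [MetricSpace V] [MeasurableSpace V] [BorelSpace V]
  (F : SelfSimilarSet k V) (p : PMF (Fin k)) {n : ℕ}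

/-- A code of a point in two distinct cells of the same level lies in the null set `multiCoded`. -/
theorem measure_cell_inter_cell (hN : symbolicBernoulli p F.multiCoded = 0) {m : ℕ}
    {w v : Fin m → Fin k} (hwv : w ≠ v) : F.measure p (F.cell w ∩ F.cell v) = 0 := by
  rw [measure, Measure.map_apply F.measurable_coding
    ((F.measurableSet_cell w).inter (F.measurableSet_cell v))]
  refine measure_mono_null (fun x hx => ?_) hN
  by_contra hc
  exact hwv (((F.coding_mem_cell_iff hc w).1 hx.1).symm.trans
    ((F.coding_mem_cell_iff hc v).1 hx.2))

theorem setIntegral_cell_stepFun (hN : symbolicBernoulli p F.multiCoded = 0) {m : ℕ}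
    (c : (Fin m → Fin k) → EuclideanSpace ℝ (Fin n)) (v : Fin m → Fin k) :
    ∫ x in F.cell v, F.stepFun p m c x ∂(F.measure p) = (F.measure p).real (F.cell v) • c v := by
  have h1 : ∀ᵐ x ∂(F.measure p), F.stepFun p m c x =
      ∑ w, (F.cell w).indicator (fun _ => c w) x := by
    have hw : ∀ᵐ x ∂(F.measure p), ∀ w : Fin m → Fin k,
        indicatorConstLp 2 (F.measurableSet_cell w) (measure_ne_top (F.measure p) _) (c w) x =
          (F.cell w).indicator (fun _ => c w) x :=
      ae_all_iff.2 fun w => indicatorConstLp_coeFn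
    filter_upwards [hw, Lp.coeFn_finsetSum Finset.univ fun w : Fin m → Fin k =>
      indicatorConstLp 2 (F.measurableSet_cell w) (measure_ne_top (F.measure p) _) (c w)]
      with x hx hs
    refine hs.trans ?_
    rw [Finset.sum_apply]
    exact Finset.sum_congr rfl fun w _ => hx w
  rw [integral_congr_ae (ae_restrict_of_ae h1), integral_finsetSum]
  · rw [Finset.sum_eq_single v]
    · rw [integral_indicator_const _ (F.measurableSet_cell v), measureReal_restrict_apply_self]
    · intro w _ hwv
      rw [integral_indicator_const _ (F.measurableSet_cell w),
        measureReal_restrict_apply (F.measurableSet_cell w), measureReal_def,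
        F.measure_cell_inter_cell p hN hwv]
      simp
    · simp
  · exact fun w _ => (integrable_const _).indicator (F.measurableSet_cell w)

/-- The coefficients on the right are those of the particle system, so its step function solves a
linear equation with a bounded operator. Overlaps of cells are null, so integration over `K_v` sees
only the coefficient `c v`. -/
theorem kernelOp_stepKernel_stepFun (hN : symbolicBernoulli p F.multiCoded = 0) {m : ℕ}
    (κ : L2Kernel n (F.measure p)) (c : (Fin m → Fin k) → EuclideanSpace ℝ (Fin n)) :
    kernelOp (F.stepKernel p m κ) (F.stepFun p m c) = F.stepFun p m fun w =>
      ∑ v, (F.measure p).real (F.cell v) • F.kernelMean p κ w v (c v) := by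
  rw [stepKernel, kernelOp_sum, sum_apply]
  refine Finset.sum_congr rfl fun w _ => ?_
  rw [kernelOp_sum, sum_apply]
  have hadd : ∀ g : (Fin m → Fin k) → EuclideanSpace ℝ (Fin n),
      indicatorConstLp 2 (F.measurableSet_cell w) (measure_ne_top (F.measure p) _) (∑ v, g v) =
        ∑ v, indicatorConstLp 2 (F.measurableSet_cell w) (measure_ne_top (F.measure p) _) (g v) :=
    fun g => map_sum (AddMonoidHom.mk' (fun a => indicatorConstLp 2 (F.measurableSet_cell w)
      (measure_ne_top (F.measure p) _) a) fun _ _ => indicatorConstLp_add.symm) g _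
  rw [hadd]
  refine Finset.sum_congr rfl fun v _ => ?_
  rw [kernelOp_indicatorConstLp _ (F.measurableSet_cell v), F.setIntegral_cell_stepFun p hN, map_smul]

theorem IsIPSSolution.hasDerivWithinAt_stepFun (hN : symbolicBernoulli p F.multiCoded = 0) {m : ℕ}
    {κ : L2Kernel n (F.measure p)} {f₀ : L2 n (F.measure p)}
    {c : ℝ → (Fin m → Fin k) → EuclideanSpace ℝ (Fin n)} (hc : F.IsIPSSolution p m κ f₀ c)
    {t : ℝ} (ht : 0 ≤ t) :
    HasDerivWithinAt (fun s => F.stepFun p m (c s))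
      (kernelOp (F.stepKernel p m κ) (F.stepFun p m (c t))) (Ici 0) t := by
  rw [F.kernelOp_stepKernel_stepFun p hN]
  exact (LinearMap.toContinuousLinearMap (F.stepFun p m)).hasFDerivAt.comp_hasDerivWithinAt t
    (hasDerivWithinAt_pi.2 fun w => hc.hasDerivWithinAt t ht w)

end Galerkin

end SelfSimilarSet

/-! ### The particle approximation -/

namespace SelfSimilarSet

section Approximation

variable {k n : ℕ} {V : Type*} [MetricSpace V] [MeasurableSpace V] [BorelSpace V]
  [SecondCountableTopology V] (F : SelfSimilarSet k V) (p : PMF (Fin k))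

theorem kernelOp_liftKernel_transport (hk : 2 ≤ k) (hN : symbolicBernoulli p F.multiCoded = 0)
    (κ : L2Kernel n (unitMeasure hk p)) (u : L2 n (unitMeasure hk p)) :
    kernelOp (F.liftKernel p n hk hN κ) (F.transport p n hk hN u) =
      F.transport p n hk hN (kernelOp κ u) :=
  kernelOp_compMeasurePreserving (F.measurePreserving_toInterval p hk hN) κ u

theorem norm_exp_smul_kernelOp_liftKernel_le (hk : 2 ≤ k)
    (hN : symbolicBernoulli p F.multiCoded = 0) (κ : L2Kernel n (unitMeasure hk p)) (t : ℝ) :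
    ‖NormedSpace.exp (t • kernelOp (F.liftKernel p n hk hN κ))‖ ≤
      ‖NormedSpace.exp (t • kernelOp κ)‖ + 2 :=
  norm_exp_smul_le_of_lift (F.transport p n hk hN) (F.kernelOp_liftKernel_transport p hk hN κ)
    (fun _ hz => kernelOp_compMeasurePreserving_eq_zero
      (F.measurePreserving_toInterval p hk hN) κ hz) t

/-- The error of the Galerkin approximation of the lifted nonlocal equation. -/
theorem IsIPSSolution.norm_stepFun_sub_transport_exp_le (hk : 2 ≤ k)
    (hN : symbolicBernoulli p F.multiCoded = 0) {κ : L2Kernel n (unitMeasure hk p)}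
    {x : L2 n (unitMeasure hk p)} {m : ℕ} {c : ℝ → (Fin m → Fin k) → EuclideanSpace ℝ (Fin n)}
    (hc : F.IsIPSSolution p m (F.liftKernel p n hk hN κ) (F.transport p n hk hN x) c)
    {T M η D : ℝ} (hM : ∀ t ∈ Icc 0 T, ‖NormedSpace.exp (t • kernelOp κ)‖ ≤ M)
    (hη : ‖F.transport p n hk hN x - F.galerkinProj p n m (F.transport p n hk hN x)‖ +
      ‖F.liftKernel p n hk hN κ - F.stepKernel p m (F.liftKernel p n hk hN κ)‖ ≤ η)
    (hD : η ≤ D) {t : ℝ} (ht : t ∈ Icc 0 T) :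
    ‖F.stepFun p m (c t) - F.transport p n hk hN (NormedSpace.exp (t • kernelOp κ) x)‖ ≤
      ((M + 2) + (M + 2) * ((M + 2) * ‖x‖) * T) * Real.exp ((M + 2) * D * T) * η := by
  have hT : 0 ≤ T := ht.1.trans ht.2
  have hM0 : 0 ≤ M := (norm_nonneg _).trans (hM t ht)
  have hη0 : 0 ≤ η := le_trans (by positivity) hη
  set J := F.transport p n hk hN with hJ
  have hexp : ∀ s ∈ Icc 0 T,
      ‖NormedSpace.exp (s • kernelOp (F.liftKernel p n hk hN κ))‖ ≤ M + 2 := fun s hs =>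
    (F.norm_exp_smul_kernelOp_liftKernel_le p hk hN κ s).trans (by linarith [hM s hs])
  have hder := fun s (hs : (0 : ℝ) ≤ s) => hc.hasDerivWithinAt_stepFun F p hN hs
  have hδ : ‖kernelOp (F.stepKernel p m (F.liftKernel p n hk hN κ)) -
      kernelOp (F.liftKernel p n hk hN κ)‖ ≤ η := by
    rw [← kernelOp_sub]
    refine (norm_kernelOp_le _).trans ?_
    rw [norm_sub_rev]
    exact (le_add_of_nonneg_left (norm_nonneg _)).trans hη
  have h := norm_sub_exp_smul_apply_le_of_perturbation _ _ hexp hδ (x := J x)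
    (W := (M + 2) * ‖x‖)
    (fun s hs => by
      rw [← J.norm_map x]
      exact ContinuousLinearMap.le_of_opNorm_le _ (hexp s hs) _)
    (v := fun s => F.stepFun p m (c s))
    (fun s hs => ((hder s hs.1).mono Icc_subset_Ici_self).continuousWithinAt)
    (fun s hs => (hder s hs.1).mono (Ici_subset_Ici.2 hs.1)) ht
  have hint : NormedSpace.exp (t • kernelOp (F.liftKernel p n hk hN κ)) (J x) =
      J (NormedSpace.exp (t • kernelOp κ) x) :=
    exp_smul_intertwine (J := J.toContinuousLinearMap)
      (F.kernelOp_liftKernel_transport p hk hN κ) t x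
  rw [hint] at h
  refine h.trans ?_
  have h0 : ‖F.stepFun p m (c 0) - J x‖ ≤ η := by
    rw [hc.initial, norm_sub_rev]
    exact (le_add_of_nonneg_right (norm_nonneg _)).trans hη
  -- In the exponent `η` is replaced by the level-independent `D`; outside it remains as the factor
  -- that carries the rate.
  calc _ ≤ ((M + 2) * η + (M + 2) * η * ((M + 2) * ‖x‖) * T) * Real.exp ((M + 2) * D * T) := by
        gcongr
    _ = _ := by ring

end Approximation

end SelfSimilarSet

/-- Powers of the number of cells in terms of the contraction ratio. -/
theorem natCast_pow_rpow_neg_div {k : ℕ} (hk : 2 ≤ k) {q : ℝ} (hq0 : 0 < q) (hq1 : q < 1)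
    {s : ℝ} (hs : s = Real.log k / Real.log (1 / q)) (a : ℝ) (m : ℕ) :
    ((k : ℝ) ^ m) ^ (-a / s) = q ^ (a * m) := by
  have hk1 : (1 : ℝ) < k := by exact_mod_cast hk
  have hlogk : 0 < Real.log k := Real.log_pos hk1
  have hlogq : Real.log q < 0 := Real.log_neg hq0 hq1
  rw [one_div, Real.log_inv] at hs
  rw [Real.rpow_def_of_pos (by positivity), Real.rpow_def_of_pos hq0, Real.log_pow, hs]
  congr 1
  field_simp

/-! ### The error bounds in terms of `ε`, `m` and the number of cells -/

theorem mainTheorem2 {d k n : ℕ} (hk : 2 ≤ k)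
    -- the self-similar set, with common contraction ratio `q`, and the probability vector `p`
    (F : SelfSimilarSet k (EuclideanSpace ℝ (Fin d))) (q : ℝ) (hq : ∀ i, F.ratio i = q)
    (p : PMF (Fin k)) (hp : ∀ i, 0 < p i) (hN : symbolicBernoulli p F.multiCoded = 0)
    -- the reference equation on `Q = [0,1]` and the regularity space `X`
    (A : L2 n (unitMeasure hk p) →ₗ.[ℝ] L2 n (unitMeasure hk p))
    (S : C0Semigroup (L2 n (unitMeasure hk p))) (hS : S.IsGenerator A)
    {X : Type*} [NormedAddCommGroup X] [NormedSpace ℝ X] [CompleteSpace X]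
    (ι : X →L[ℝ] L2 n (unitMeasure hk p)) (hι : Function.Injective ι) (hιd : DenseRange ι)
    (hXA : ∀ x, ι x ∈ A.domain)
    -- the nonlocal approximations
    (σ : ℝ → L2Kernel n (unitMeasure hk p)) (r : ℝ → ℝ)
    (hA : StableConsistent ι A (fun ε => kernelOp (σ ε)) r)
    -- the reference solution remains (boundedly) in `X` on `[0, T]`
    (u₀ : X) (T : ℝ) (hT : 0 < T)
    (hreg : ∃ B : ℝ, ∀ t : ℝ≥0, (t : ℝ) ≤ T → ∃ x : X, ι x = S.op t (ι u₀) ∧ ‖x‖ ≤ B)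
    -- the solutions of the particle systems
    (c : ℝ → (m : ℕ) → ℝ → (Fin m → Fin k) → EuclideanSpace ℝ (Fin n))
    (hc : ∀ ε, 0 < ε → ∀ m, F.IsIPSSolution p m (F.liftKernel p n hk hN (σ ε))
      (F.transport p n hk hN (ι u₀)) (c ε m))
    -- the bounds, for all pairs `(ε, m)` in a set `P` (possibly the set of all pairs)
    (α β C : ℝ) (hα : 0 < α) (hβ : 0 < β) (hC : 0 < C) (P : Set (ℝ × ℕ))
    (hGal : ∀ ε m, 0 < ε → (ε, m) ∈ P →
      ‖F.transport p n hk hN (ι u₀) - F.galerkinProj p n m (F.transport p n hk hN (ι u₀))‖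
        + ‖F.liftKernel p n hk hN (σ ε) - F.stepKernel p m (F.liftKernel p n hk hN (σ ε))‖
        ≤ C * q ^ (α * m))
    (hr : ∀ ε m, 0 < ε → (ε, m) ∈ P → r ε ≤ C * ε ^ β)
    -- the similarity dimension
    (s : ℝ) (hs : s = Real.log k / Real.log (1 / q)) :
    -- the two-scale error bound
    (∃ C_T : ℝ, ∀ ε m, 0 < ε → (ε, m) ∈ P → ∀ t : ℝ≥0, (t : ℝ) ≤ T →
      ‖F.stepFun p m (c ε m t) - F.transport p n hk hN (S.op t (ι u₀))‖
        ≤ C_T * (ε ^ β + q ^ (α * m))) ∧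
    -- the balanced choice of `m` given `ε`
    (∃ C_T : ℝ, ∀ ε m, 0 < ε → (ε, m) ∈ P →
      q ^ (α * m) ≤ ε ^ β → ε ^ β < q ^ (α * ((m : ℝ) - 1)) → ∀ t : ℝ≥0, (t : ℝ) ≤ T →
      ‖F.stepFun p m (c ε m t) - F.transport p n hk hN (S.op t (ι u₀))‖ ≤ C_T * ε ^ β) ∧
    -- the same in terms of the number `N_m = k ^ m` of cells
    (∀ m : ℕ, q ^ m = ((k : ℝ) ^ m) ^ (-1 / s)) ∧
    (∀ (ε : ℝ) (m : ℕ), 0 < ε →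
      q ^ (α * m) ≤ ε ^ β → ε ^ β < q ^ (α * ((m : ℝ) - 1)) →
      ((k : ℝ) ^ m) ^ (-α / (β * s)) ≤ ε ∧
        ε < q ^ (-α / β) * ((k : ℝ) ^ m) ^ (-α / (β * s))) ∧
    (∀ c₁ c₂ : ℝ, 0 < c₁ → 0 < c₂ → ∃ C_T : ℝ, ∀ ε m, 0 < ε → (ε, m) ∈ P →
      c₁ * ((k : ℝ) ^ m) ^ (-α / (β * s)) ≤ ε →
      ε ≤ c₂ * ((k : ℝ) ^ m) ^ (-α / (β * s)) → ∀ t : ℝ≥0, (t : ℝ) ≤ T →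
      ‖F.stepFun p m (c ε m t) - F.transport p n hk hN (S.op t (ι u₀))‖
        ≤ C_T * ((k : ℝ) ^ m) ^ (-α / s)) := by
  have hq0 : 0 < q := hq ⟨0, by omega⟩ ▸ F.ratio_pos _
  have hq1 : q < 1 := hq ⟨0, by omega⟩ ▸ F.ratio_lt_one _
  have hpow := natCast_pow_rpow_neg_div hk hq0 hq1 hs
  have hpowβ : ∀ m : ℕ, ((k : ℝ) ^ m) ^ (-α / (β * s)) = q ^ (α / β * m) := fun m => by
    rw [← hpow, ← neg_div, div_div]
  have hqm : ∀ m : ℕ, 0 < q ^ (α * m) := fun m => Real.rpow_pos_of_pos hq0 _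
  have main : ∃ C_T : ℝ, 0 ≤ C_T ∧ ∀ ε m, 0 < ε → (ε, m) ∈ P → ∀ t : ℝ≥0, (t : ℝ) ≤ T →
      ‖F.stepFun p m (c ε m t) - F.transport p n hk hN (S.op t (ι u₀))‖
        ≤ C_T * (ε ^ β + q ^ (α * m)) := by
    obtain ⟨M, hM1, hM⟩ := hA.exists_norm_exp_le T
    obtain ⟨B, hB⟩ := hreg
    -- The regularity bound at time 0 yields `B ≥ 0`.
    obtain ⟨φ, -, hφB⟩ := hB 0 hT.le
    have hB0 : 0 ≤ B := (norm_nonneg _).trans hφB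
    set K₁ : ℝ := ((M + 2) + (M + 2) * ((M + 2) * ‖ι u₀‖) * T) * Real.exp ((M + 2) * C * T) * C
      with hK₁
    have hM0 : 0 ≤ M := by linarith
    refine ⟨K₁ + M * (C * B) * T, by positivity, fun ε m hε hP t ht => ?_⟩
    have hεβ : 0 < ε ^ β := Real.rpow_pos_of_pos hε _
    have hqm1 : q ^ (α * m) ≤ 1 := Real.rpow_le_one hq0.le hq1.le (by positivity)
    -- Since `q^{αm} ≤ 1`, the Gronwall exponent is controlled with `D = C` for all levels.
    have h1 := (hc ε hε m).norm_stepFun_sub_transport_exp_le F p hk hN (hM ε hε)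
      (hGal ε m hε hP) (mul_le_of_le_one_right hC.le hqm1) ⟨t.2, ht⟩
    have h2 := hA.norm_exp_sub_orbit_le hS hXA hε (hM ε hε) hB (R := C * ε ^ β) (by positivity)
      (hr ε m hε hP) ht
    -- The isometry `T⁻¹` carries the estimate from `Q` to `K`.
    rw [norm_sub_rev, ← (F.transport p n hk hN).norm_map, map_sub] at h2
    calc _ ≤ K₁ * q ^ (α * m) + M * (C * B) * T * ε ^ β := by
          refine (norm_sub_le_norm_sub_add_norm_sub _ _ _).trans
            (add_le_add (h1.trans_eq (by rw [hK₁]; ring)) (h2.trans ?_))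
          calc M * (C * ε ^ β * B) * t ≤ M * (C * ε ^ β * B) * T := by gcongr
            _ = _ := by ring
      _ ≤ (K₁ + M * (C * B) * T) * q ^ (α * m) + (K₁ + M * (C * B) * T) * ε ^ β := by
          gcongr
          · exact le_add_of_nonneg_right (by positivity)
          · exact le_add_of_nonneg_left (by positivity)
      _ = _ := by ring
  obtain ⟨C_T, hC_T, hmain⟩ := main
  -- The factor 2 comes from `q^{αm} ≤ ε^β`, the factor `c₂^β + 1` from `ε^β ≤ c₂^β q^{αm}`.
  refine ⟨⟨C_T, hmain⟩, ⟨2 * C_T, fun ε m hε hP hle _ t ht => ?_⟩, fun m => ?_,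
    fun ε m hε hle hlt => ?_, fun c₁ c₂ hc₁ hc₂ => ⟨C_T * (c₂ ^ β + 1),
      fun ε m hε hP _ hle t ht => ?_⟩⟩
  · calc _ ≤ C_T * (ε ^ β + q ^ (α * m)) := hmain ε m hε hP t ht
      _ ≤ C_T * (ε ^ β + ε ^ β) := by gcongr
      _ = _ := by ring
  · rw [hpow 1 m, one_mul, Real.rpow_natCast]
  -- Both bounds on `ε` are the balancing inequalities raised to the power `1/β`; the shift from `m`
  -- to `m - 1` produces the factor `q^{-α/β}`.
  · have hε' : (ε ^ β) ^ β⁻¹ = ε := Real.rpow_rpow_inv hε.le hβ.ne'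
    rw [hpowβ, ← Real.rpow_add hq0]
    constructor
    · rw [← hε', show α / β * m = α * m * β⁻¹ by field_simp, Real.rpow_mul hq0.le]
      exact Real.rpow_le_rpow (hqm m).le hle (by positivity)
    · rw [← hε', show -α / β + α / β * m = α * ((m : ℝ) - 1) * β⁻¹ by field_simp; ring,
        Real.rpow_mul hq0.le]
      exact Real.rpow_lt_rpow (by positivity) hlt (by positivity)
  · have hεβ : ε ^ β ≤ c₂ ^ β * q ^ (α * m) := by
      rw [hpowβ] at hle
      refine (Real.rpow_le_rpow hε.le hle hβ.le).trans_eq ?_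
      rw [Real.mul_rpow hc₂.le (by positivity), ← Real.rpow_mul hq0.le]
      congr 2
      field_simp
    rw [hpow]
    calc _ ≤ C_T * (ε ^ β + q ^ (α * m)) := hmain ε m hε hP t ht
      _ ≤ C_T * (c₂ ^ β * q ^ (α * m) + q ^ (α * m)) := by gcongr
      _ = _ := by ring
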